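/- **Theorem.** Let $n\ge 1$, $0<p,q<\infty$, let $\psi,w:(0,\infty)\to[0,\infty]$ be measurable and let $\varphi:(0,\infty)\to(0,\infty)$ be non-increasing and such that $r\mapsto\varphi(r)r^{1/p}$ is non-decreasing on $(0,\infty)$. For measurable $f:\mathbb R^n\to[-\infty,\infty]$ with decreasing rearrangement $f^*$ put $$\|f\|_{G\Lambda_{p,\psi;\varphi}}=\sup_{r>0}\varphi(r)\Big(\int_0^r(\psi f^*)^p\Big)^{1/p},\qquad \|f\|_{\Lambda_{q,w}}=\Big(\int_0^\infty (w f^*)^q\Big)^{1/q},$$ and let $G\Lambda_{p,\psi;\varphi}$, $\Lambda_{q,w}$ be the sets of those measurable $f$ for which the respective functional is finite. Put $$\Psi_{p/q}(t)=\|\psi^q\|_{p/q,(0,t)}=\Big(\int_0^t\psi^p\Big)^{q/p},$$ and assume that $\Psi_{p/q}$ is admissible, that is, a finite, continuous, strictly increasing function on $[0,\infty)$ with $\Psi_{p/q}(0)=0$ and $\Psi_{p/q}(t)\to\infty$ as $t\to\infty$. Let $\nu$ be a representation measure of $1/\varphi^q$ with respect to $\Psi_{p/q}$, that is, a non-negative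 Borel measure on $[0,\infty)$ for which there is a constant $C<\infty$ with $$\frac1C\,\frac{1}{\varphi(t)^q}\le \Psi_{p/q}(t)\int_{[0,\infty)}\frac{d\nu(s)}{\Psi_{p/q}(s)+\Psi_{p/q}(t)}\le \frac{C}{\varphi(t)^q}\qquad (t>0).$$ Then the embedding $G\Lambda_{p,\psi;\varphi}\hookrightarrow\Lambda_{q,w}$ (inclusion together with $\|f\|_{\Lambda_{q,w}}\le C'\|f\|_{G\Lambda_{p,\psi;\varphi}}$ for all $f\in G\Lambda_{p,\psi;\varphi}$, with a finite constant $C'$ independent of $f$) holds if and only if (i) in the case $p\le q$, $$\int_{[0,\infty)}\ \sup_{s\in(t,\infty)}\frac{\int_0^s w(x)^q\,dx}{\Psi_{p/q}(s)}\,d\nu(t)<\infty;$$ (ii) in the case $q<p$, with $(p/q)'=\frac{p}{p-q}$, $$\int_{[0,\infty)}\left(\int_t^\infty\left(\frac{\int_0^s w(x)^q\,dx}{\Psi_{p/q}(s)^{p/q}}\right)^{(p/q)'}\psi(s)^p\,ds\right)^{1/(p/q)'}d\nu(t)<\infty .$$ -/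

import Mathlib

open MeasureTheory Set Filter Topology
open scoped ENNReal NNReal

noncomputable section

namespace LorentzEmb

/-- The quasinorm `‖g‖_{p,S} = (∫_S g^p)^{1/p}` for `0 < p < ∞` of a function with values
in `[0, ∞]`. -/
def lpOn (p : ℝ) (g : ℝ → ℝ≥0∞) (S : Set ℝ) : ℝ≥0∞ :=
  (∫⁻ s in S, g s ^ p) ^ (1 / p)

/-- The distribution function `α ↦ |{x : |f x| > α}|` of an extended real valued function
on `ℝⁿ`. -/
def distribution {n : ℕ} (f : EuclideanSpace ℝ (Fin n) → EReal) (α : ℝ≥0∞) : ℝ≥0∞ :=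
  volume {x | α < (f x).abs}

/-- The decreasing rearrangement `f*(t) = inf {l > 0 : |{|f| > l}| ≤ t}`. Admitting `l = ∞`
encodes the convention `inf ∅ = ∞`. -/
def rearrangement {n : ℕ} (f : EuclideanSpace ℝ (Fin n) → EReal) (t : ℝ) : ℝ≥0∞ :=
  sInf {l : ℝ≥0∞ | 0 < l ∧ distribution f l ≤ ENNReal.ofReal t}

/-- `‖f‖_{Λ_{q,w}} = ‖w f*‖_{q,(0,∞)}`. -/
def lambdaNorm {n : ℕ} (q : ℝ) (w : ℝ → ℝ≥0∞) (f : EuclideanSpace ℝ (Fin n) → EReal) : ℝ≥0∞ :=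
  lpOn q (fun t => w t * rearrangement f t) (Ioi 0)

/-- `‖f‖_{GΛ_{p,ψ;φ}} = sup_{r > 0} φ(r) ‖ψ f*‖_{p,(0,r)}`. -/
def gLambdaNorm {n : ℕ} (p : ℝ) (ψ φ : ℝ → ℝ≥0∞) (f : EuclideanSpace ℝ (Fin n) → EReal) : ℝ≥0∞ :=
  ⨆ r ∈ Ioi (0 : ℝ), φ r * lpOn p (fun t => ψ t * rearrangement f t) (Ioo 0 r)

/-- The classical Lorentz space `Λ_{q,w}(ℝⁿ)`; `f` ranges over the Lebesgue measurable
extended real valued functions. -/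
def Lambda (n : ℕ) (q : ℝ) (w : ℝ → ℝ≥0∞) : Set (EuclideanSpace ℝ (Fin n) → EReal) :=
  {f | AEMeasurable f volume ∧ lambdaNorm q w f < ∞}

/-- The generalized classical Lorentz space `GΛ_{p,ψ;φ}(ℝⁿ)`. -/
def GLambda (n : ℕ) (p : ℝ) (ψ φ : ℝ → ℝ≥0∞) : Set (EuclideanSpace ℝ (Fin n) → EReal) :=
  {f | AEMeasurable f volume ∧ gLambdaNorm p ψ φ f < ∞}

/-- The continuous embedding `GΛ_{p,ψ;φ}(ℝⁿ) ↪ Λ_{q,w}(ℝⁿ)`. -/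
def Embeds (n : ℕ) (p q : ℝ) (ψ φ w : ℝ → ℝ≥0∞) : Prop :=
  GLambda n p ψ φ ⊆ Lambda n q w ∧
    ∃ C : ℝ≥0, ∀ f ∈ GLambda n p ψ φ, lambdaNorm q w f ≤ C * gLambdaNorm p ψ φ f

/-- Admissible functions on `[0, ∞)`: finite, continuous, strictly increasing, zero at zero and
tending to infinity at infinity. -/
structure IsAdmissible (θ : ℝ → ℝ≥0∞) : Prop where
  finite : ∀ t ∈ Ici (0 : ℝ), θ t < ∞
  continuousOn : ContinuousOn θ (Ici 0)
  strictMonoOn : StrictMonoOn θ (Ici 0)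
  map_zero : θ 0 = 0
  tendsto_atTop : Tendsto θ atTop (𝓝 ∞)

/-- The fundamental function `t ↦ σ(t) ∫_{[0,∞)} dν(s) / (σ(s) + σ(t))` of a Borel measure `ν`
on `[0, ∞)` with respect to `σ`. -/
def fundamentalFunction (σ : ℝ → ℝ≥0∞) (ν : Measure ℝ≥0) (t : ℝ) : ℝ≥0∞ :=
  σ t * ∫⁻ s : ℝ≥0, (σ (s : ℝ) + σ t)⁻¹ ∂ν

/-- `ν` is a representation measure of `h` with respect to `σ`: the function `h` is equivalent
on `(0, ∞)` (up to multiplicative constants) to the fundamental function of `ν`. -/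
def IsRepresentationMeasure (σ h : ℝ → ℝ≥0∞) (ν : Measure ℝ≥0) : Prop :=
  ∃ C : ℝ≥0, ∀ t ∈ Ioi (0 : ℝ),
    h t ≤ C * fundamentalFunction σ ν t ∧ fundamentalFunction σ ν t ≤ C * h t

/-- `Ψ_{p/q}(t) = ‖ψ^q‖_{p/q,(0,t)}`. -/
def Psi (p q : ℝ) (ψ : ℝ → ℝ≥0∞) (t : ℝ) : ℝ≥0∞ :=
  lpOn (p / q) (fun s => ψ s ^ q) (Ioo 0 t)

/-- `∫_0^t w^q`. -/
def primitivePow (q : ℝ) (w : ℝ → ℝ≥0∞) (t : ℝ) : ℝ≥0∞ :=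
  ∫⁻ s in Ioo 0 t, w s ^ q

/-- `∫_{[0,∞)} sup_{s > t} (∫_0^s w^q) / Ψ_{p/q}(s) dν(t)`. -/
def supIntegral (p q : ℝ) (ψ w : ℝ → ℝ≥0∞) (ν : Measure ℝ≥0) : ℝ≥0∞ :=
  ∫⁻ t : ℝ≥0, ⨆ s ∈ Ioi (t : ℝ), primitivePow q w s / Psi p q ψ s ∂ν

/-- `∫_{[0,∞)} (∫_t^∞ ((∫_0^s w^q) / Ψ_{p/q}(s)^{p/q})^{(p/q)'} ψ(s)^p ds)^{1/(p/q)'} dν(t)`,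
where `(p/q)'` is the conjugate exponent of `p/q`. -/
def conjIntegral (p q : ℝ) (ψ w : ℝ → ℝ≥0∞) (ν : Measure ℝ≥0) : ℝ≥0∞ :=
  ∫⁻ t : ℝ≥0, (∫⁻ s in Ioi (t : ℝ),
    (primitivePow q w s / Psi p q ψ s ^ (p / q)) ^ (p / q).conjExponent * ψ s ^ p)
      ^ (1 / (p / q).conjExponent) ∂ν

end LorentzEmb

end

/-!
Write `α = q / p`, let `μ` be the measure `ψ ^ p dt` and `ω` the measure `w ^ q dt` on `(0, ∞)`, and
put `Ψ t = μ (-∞, t)`, so that `Psi p q ψ = Ψ ^ α`. With `F = (f*) ^ p` the embedding becomes an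
inequality for non-increasing functions `F`: if `(∫_{(0, r)} F dμ) ^ α` is at most the fundamental
function `h` of `ν` for all `r`, then `∫ F ^ α dω` is bounded by a constant. Every non-increasing
function is a rearrangement up to a null set (`exists_rearrangement_ae_eq`).

The central object is the `gain` at `t`: the largest value of `∫ F ^ α dω` over non-increasing `F`
of `μ`-mass at most one which are constant up to `t`. It is the norm of the embedding when `ν` is the unit
mass at `t`, up to constants. It is non-increasing, and its product with `Ψ ^ α` is non-decreasing
up to a constant (`rpow_mul_gain_le`). For general `ν` the embedding holds if and only if the gain
is integrable with respect to `ν` (`embeds_iff_lintegral_gain_lt_top`), for all `α > 0` at once.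
This rests on a discretizing sequence `x k` (`IsProfile.exists_isDiscretization`), along which both
`h` and `Ψ ^ α / h` grow geometrically, while each interval between neighbours consists of a part
where `h` is essentially constant followed by a part where `h / Ψ ^ α` is.

* Sufficiency (`exists_lintegral_rpow_le`): on the two kinds of intervals `F ^ α` is dominated by
  test functions for the adjacent points `x k`, so `∫ F ^ α dω` is at most a multiple of
  `∑ h (x k) * gain (x k)`. By the geometric growth the value `h (x k)` comes mostly from the part
  of `ν` near `x k`, which bounds the sum by the integral of the gain.
* Necessity (`exists_lintegral_gain_le`): conversely the integral of the gain is at most a multiple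
  of the same sum, the gain at `x k` can be localized to the neighbouring intervals, and the sum
  `∑ h (x k) ^ (1 / α) * F k` of near-optimal test functions is admissible up to a factor
  (`sum_mul_setLIntegral_le`).

It remains to evaluate the gain. For `α ≥ 1` level sets reduce it to characteristic functions, which
gives the supremum of `ω (0, s) / Ψ s ^ α` over `s > t` (`gain_le_mul_iSup_div`). For `α < 1` it is
comparable to `(∫_t^∞ (ω (0, y) / Ψ y) ^ (1 - α)⁻¹ dμ(y)) ^ (1 - α)`, by Hölder's inequality and an
explicit extremal function (`exists_gain_le_mul_lintegral`, `rpow_lintegral_le_mul_gain`).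
-/

namespace LorentzEmb

section

/-! ### The gain function of an embedding -/

/-- A measure on `(0, ∞)` whose distribution function `t ↦ μ (-∞, t)` is an admissible
time scale: finite, continuous, strictly increasing and unbounded on `(0, ∞)`. -/
structure IsClock (μ : Measure ℝ) : Prop where
  null : μ (Iic 0) = 0
  lt_top : ∀ t, μ (Iio t) < ∞
  strictMono : StrictMonoOn (fun t => μ (Iio t)) (Ici 0)
  continuous : Continuous fun t => μ (Iio t)
  tendsto_atTop : Tendsto (fun t => μ (Iio t)) atTop (𝓝 ∞)

/-- The non-increasing functions of mass at most one with respect to `μ` which are constant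
on `(-∞, t]`. -/
def TestFun (μ : Measure ℝ) (t : ℝ) : Set (ℝ → ℝ≥0∞) :=
  {F | Antitone F ∧ (∀ s ≤ t, F s = F t) ∧ ∫⁻ s, F s ∂μ ≤ 1}

/-- The largest value of `∫ F ^ α dω` over the test functions which are constant up to `t`. -/
noncomputable def gain (μ ω : Measure ℝ) (α : ℝ) (t : ℝ) : ℝ≥0∞ :=
  ⨆ F ∈ TestFun μ t, ∫⁻ s, F s ^ α ∂ω

variable {μ ω : Measure ℝ} {α : ℝ}

lemma IsClock.measure_Iio_zero (hμ : IsClock μ) : μ (Iio 0) = 0 :=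
  measure_mono_null Iio_subset_Iic_self hμ.null

lemma IsClock.pos (hμ : IsClock μ) (t : ℝ) (ht : 0 < t) : 0 < μ (Iio t) := by
  have h := hμ.strictMono self_mem_Ici ht.le ht
  simpa only [hμ.measure_Iio_zero] using h

lemma mul_measure_le_lintegral {F : ℝ → ℝ≥0∞} (hF : Antitone F) (t : ℝ) :
    F t * μ (Iio t) ≤ ∫⁻ s in Iio t, F s ∂μ := by
  rw [← setLIntegral_const]
  exact setLIntegral_mono' measurableSet_Iio fun s hs => hF (le_of_lt hs)

lemma TestFun.le_inv (hμ : IsClock μ) {t : ℝ} (ht : 0 < t) {F : ℝ → ℝ≥0∞}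
    (hF : F ∈ TestFun μ t) : F t ≤ (μ (Iio t))⁻¹ := by
  rw [← one_div, ENNReal.le_div_iff_mul_le (Or.inl (hμ.pos t ht).ne') (Or.inl (hμ.lt_top t).ne)]
  exact (mul_measure_le_lintegral hF.1 t).trans ((setLIntegral_le_lintegral _ _).trans hF.2.2)

lemma gain_antitone : Antitone (gain μ ω α) := by
  intro t t' h
  refine iSup₂_le fun F hF => le_iSup₂_of_le F ⟨hF.1, fun s hs => ?_, hF.2.2⟩ le_rfl
  rw [hF.2.1 s (hs.trans h), hF.2.1 t h]

lemma zero_mem_testFun (t : ℝ) : (fun _ => 0) ∈ TestFun μ t :=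
  ⟨fun _ _ _ => le_rfl, fun _ _ => rfl, by simp⟩

/-- The gain bounds test functions of any finite mass, by homogeneity. -/
lemma lintegral_rpow_le_gain (hα : 0 < α) {t : ℝ} {F : ℝ → ℝ≥0∞} (hF : Antitone F)
    (hc : ∀ s ≤ t, F s = F t) {c : ℝ≥0∞} (hc0 : c ≠ 0) (hct : c ≠ ∞)
    (hFc : ∫⁻ s, F s ∂μ ≤ c) : ∫⁻ s, F s ^ α ∂ω ≤ c ^ α * gain μ ω α t := by
  have hG : (fun s => c⁻¹ * F s) ∈ TestFun μ t := by
    refine ⟨fun x y h => mul_le_mul_right (hF h) _, fun s hs => by simp only [hc s hs], ?_⟩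
    rw [lintegral_const_mul _ hF.measurable]
    calc c⁻¹ * ∫⁻ s, F s ∂μ ≤ c⁻¹ * c := by gcongr
      _ = 1 := ENNReal.inv_mul_cancel hc0 hct
  calc ∫⁻ s, F s ^ α ∂ω = c ^ α * ∫⁻ s, (c⁻¹ * F s) ^ α ∂ω := by
        rw [← lintegral_const_mul' _ _ (ENNReal.rpow_ne_top_of_nonneg hα.le hct)]
        congr 1 with s
        rw [← ENNReal.mul_rpow_of_nonneg _ _ hα.le, ← mul_assoc,
          ENNReal.mul_inv_cancel hc0 hct, one_mul]
    _ ≤ _ := by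
        gcongr
        exact le_iSup₂_of_le (f := fun F _ => ∫⁻ s, F s ^ α ∂ω) _ hG le_rfl

/-- The gain decays at most like `μ (Iio t) ^ (-α)`: flattening a test function up to `t'`
increases its mass by a factor of at most `2 * μ (Iio t') / μ (Iio t)`. -/
lemma rpow_mul_gain_le [NullSingletonClass μ] (hμ : IsClock μ) (hα : 0 < α) {t t' : ℝ}
    (ht : 0 < t) (h : t ≤ t') :
    μ (Iio t) ^ α * gain μ ω α t ≤ 2 ^ α * (μ (Iio t') ^ α * gain μ ω α t') := by
  have ht' := ht.trans_le h
  have hp := (hμ.pos t ht).ne'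
  have hp' := (hμ.pos t' ht').ne'
  have hf := (hμ.lt_top t).ne
  have hf' := (hμ.lt_top t').ne
  have hΨ : μ (Iio t) ≤ μ (Iio t') := measure_mono (Iio_subset_Iio h)
  unfold gain
  rw [ENNReal.mul_iSup]
  refine iSup_le fun F => ?_
  rw [ENNReal.mul_iSup]
  refine iSup_le fun hF => ?_
  have hle := TestFun.le_inv hμ ht hF
  let G : ℝ → ℝ≥0∞ := fun s => if s ≤ t' then F t else F s
  have hGa : Antitone G := by
    intro x y hxy
    simp only [G]
    split_ifs with h1 h2 h2
    · exact le_rfl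
    · exact absurd (hxy.trans h1) h2
    · exact hF.1 (h.trans (not_le.1 h1).le)
    · exact hF.1 hxy
  have hGm : ∫⁻ s, G s ∂μ ≤ 2 * μ (Iio t') / μ (Iio t) := by
    calc ∫⁻ s, G s ∂μ ≤ ∫⁻ s, ((Iic t').indicator (fun _ => F t) s + F s) ∂μ := by
          refine lintegral_mono fun s => ?_
          simp only [G, indicator, mem_Iic]
          split_ifs <;> simp
      _ = F t * μ (Iio t') + ∫⁻ s, F s ∂μ := by
          rw [lintegral_add_right _ hF.1.measurable, lintegral_indicator_const measurableSet_Iic,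
            measure_congr Iio_ae_eq_Iic]
      _ ≤ (μ (Iio t))⁻¹ * μ (Iio t') + μ (Iio t') / μ (Iio t) := by
          gcongr
          refine hF.2.2.trans ?_
          rw [ENNReal.le_div_iff_mul_le (Or.inl hp) (Or.inl hf), one_mul]
          exact hΨ
      _ = _ := by rw [ENNReal.div_eq_inv_mul, ENNReal.div_eq_inv_mul]; ring
  have hc0 : 2 * μ (Iio t') / μ (Iio t) ≠ 0 := by simp [hp', hf]
  have hct : 2 * μ (Iio t') / μ (Iio t) ≠ ∞ :=
    ENNReal.div_ne_top (ENNReal.mul_ne_top (by simp) hf') hp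
  have key := lintegral_rpow_le_gain (ω := ω) hα hGa
    (fun s hs => by simp [G, hs] : ∀ s ≤ t', G s = G t') hc0 hct hGm
  calc μ (Iio t) ^ α * ∫⁻ s, F s ^ α ∂ω ≤ μ (Iio t) ^ α * ∫⁻ s, G s ^ α ∂ω := by
        gcongr with s
        simp only [G]
        split_ifs with h1
        · rcases le_total s t with h2 | h2
          · rw [hF.2.1 s h2]
          · exact hF.1 h2
        · exact le_rfl
    _ ≤ μ (Iio t) ^ α * ((2 * μ (Iio t') / μ (Iio t)) ^ α * gain μ ω α t') := by gcongr
    _ = _ := by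
        rw [← mul_assoc, ← ENNReal.mul_rpow_of_nonneg _ _ hα.le, ENNReal.mul_div_cancel hp hf,
          ENNReal.mul_rpow_of_nonneg _ _ hα.le, mul_assoc]
        rfl

lemma indicator_mem_testFun [NullSingletonClass μ] (hμ : IsClock μ) {x t : ℝ} (hx : 0 < x)
    (h : t ≤ x) : (Iic x).indicator (fun _ => (μ (Iio x))⁻¹) ∈ TestFun μ t := by
  refine ⟨fun a b hab => ?_, fun s hs => ?_, ?_⟩
  · simp only [indicator, mem_Iic]
    split_ifs with h1 h2
    · exact le_rfl
    · exact absurd (hab.trans h1) h2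
    · simp
    · simp
  · simp [indicator, h, hs.trans h]
  · rw [lintegral_indicator_const measurableSet_Iic, ← measure_congr Iio_ae_eq_Iic,
      ENNReal.inv_mul_cancel (hμ.pos x hx).ne' (hμ.lt_top x).ne]

/-- The gain at `t` dominates the quotients `ω (Iio x) / μ (Iio x) ^ α` for `x ≥ t`. -/
lemma measure_le_gain [NullSingletonClass μ] [NullSingletonClass ω] (hμ : IsClock μ)
    (hα : 0 < α) {x t : ℝ} (hx : 0 < x) (h : t ≤ x) :
    ω (Iio x) ≤ μ (Iio x) ^ α * gain μ ω α t := by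
  have hp := (hμ.pos x hx).ne'
  have hf := (hμ.lt_top x).ne
  have h1 : ∫⁻ s, (Iic x).indicator (fun _ => (μ (Iio x))⁻¹) s ^ α ∂ω ≤ gain μ ω α t :=
    le_iSup₂_of_le (f := fun F _ => ∫⁻ s, F s ^ α ∂ω) _ (indicator_mem_testFun hμ hx h) le_rfl
  have h2 : ∀ s, (Iic x).indicator (fun _ => (μ (Iio x))⁻¹) s ^ α
      = (Iic x).indicator (fun _ => (μ (Iio x))⁻¹ ^ α) s := by
    intro s
    by_cases hs : s ∈ Iic x <;> simp [hs, hα]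
  simp_rw [h2] at h1
  rw [lintegral_indicator_const measurableSet_Iic, ← measure_congr Iio_ae_eq_Iic] at h1
  calc ω (Iio x) = μ (Iio x) ^ α * ((μ (Iio x))⁻¹ ^ α * ω (Iio x)) := by
        rw [← mul_assoc, ← ENNReal.mul_rpow_of_nonneg _ _ hα.le, ENNReal.mul_inv_cancel hp hf,
          ENNReal.one_rpow, one_mul]
    _ ≤ _ := by gcongr

end

section

/-! ### Geometric sums -/

lemma sum_le_two_mul_of_succ_le {b r : ℕ → ℝ≥0∞} {m : ℕ} (h0 : b 0 ≤ r 0)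
    (h : ∀ k < m, b (k + 1) ≤ r (k + 1) + b k / 2) :
    ∑ k ∈ Finset.range (m + 1), b k ≤ 2 * ∑ k ∈ Finset.range (m + 1), r k := by
  -- The term `b n` on the left is what makes the induction close.
  have key : ∀ n ≤ m, ∑ k ∈ Finset.range (n + 1), b k + b n
      ≤ 2 * ∑ k ∈ Finset.range (n + 1), r k := by
    intro n
    induction n with
    | zero => intro _; simp only [zero_add, Finset.sum_range_one]; rw [← two_mul]; gcongr
    | succ n ih =>
      intro hn
      have ih := ih (by omega)
      rw [Finset.sum_range_succ, Finset.sum_range_succ _ (n + 1)]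
      have h2 : 2 * (b n / 2) = b n := ENNReal.mul_div_cancel (by simp) (by simp)
      calc ∑ k ∈ Finset.range (n + 1), b k + b (n + 1) + b (n + 1)
          = ∑ k ∈ Finset.range (n + 1), b k + 2 * b (n + 1) := by ring
        _ ≤ ∑ k ∈ Finset.range (n + 1), b k + 2 * (r (n + 1) + b n / 2) := by
            gcongr; exact h n (by omega)
        _ = (∑ k ∈ Finset.range (n + 1), b k + b n) + 2 * r (n + 1) := by
            rw [mul_add, h2]; ring
        _ ≤ 2 * ∑ k ∈ Finset.range (n + 1), r k + 2 * r (n + 1) := by gcongr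
        _ = _ := by ring
  exact le_self_add.trans (key m le_rfl)

lemma sum_le_two_mul_of_le_succ {b r : ℕ → ℝ≥0∞} {m : ℕ} (h0 : b m ≤ r m)
    (h : ∀ k < m, b k ≤ r k + b (k + 1) / 2) :
    ∑ k ∈ Finset.range (m + 1), b k ≤ 2 * ∑ k ∈ Finset.range (m + 1), r k := by
  rw [← Finset.sum_range_reflect, ← Finset.sum_range_reflect r]
  refine sum_le_two_mul_of_succ_le (b := fun k => b (m + 1 - 1 - k))
    (r := fun k => r (m + 1 - 1 - k)) (by simpa using h0) fun k hk => ?_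
  have h1 := h (m + 1 - 1 - (k + 1)) (by omega)
  have h2 : m + 1 - 1 - (k + 1) + 1 = m + 1 - 1 - k := by omega
  rwa [h2] at h1

lemma sum_ite_le_of_doubling {η : ℕ → ℝ≥0∞} {m : ℕ} {A : ℝ≥0∞} (P : ℕ → Prop) [DecidablePred P]
    (h : ∀ k < m, 2 * η k ≤ η (k + 1)) (hA : ∀ k ≤ m, P k → η k ≤ A) :
    ∑ k ∈ Finset.range (m + 1), (if P k then η k else 0) ≤ 2 * A := by
  have geo : ∀ n ≤ m, ∑ k ∈ Finset.range (n + 1), η k ≤ 2 * η n := by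
    intro n
    induction n with
    | zero => intro _; simp only [zero_add, Finset.sum_range_one]; rw [two_mul]; exact le_self_add
    | succ n ih =>
      intro hn
      rw [Finset.sum_range_succ, two_mul]
      gcongr
      exact (ih (by omega)).trans (h n (by omega))
  have key : ∀ n ≤ m, ∑ k ∈ Finset.range (n + 1), (if P k then η k else 0) ≤ 2 * A := by
    intro n
    induction n with
    | zero =>
      intro _
      simp only [zero_add, Finset.sum_range_one]
      split_ifs with hP
      · exact (hA 0 (by omega) hP).trans (by rw [two_mul]; exact le_self_add)
      · simp
    | succ n ih =>
      intro hn
      by_cases hP : P (n + 1)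
      · refine le_trans (Finset.sum_le_sum fun k _ => ?_) ((geo (n + 1) hn).trans ?_)
        · split_ifs <;> simp
        · gcongr; exact hA _ hn hP
      · rw [Finset.sum_range_succ, if_neg hP, add_zero]
        exact ih (by omega)
  exact key m le_rfl

lemma sum_ite_le_of_halving {η : ℕ → ℝ≥0∞} {m : ℕ} {A : ℝ≥0∞} (P : ℕ → Prop) [DecidablePred P]
    (h : ∀ k < m, 2 * η (k + 1) ≤ η k) (hA : ∀ k ≤ m, P k → η k ≤ A) :
    ∑ k ∈ Finset.range (m + 1), (if P k then η k else 0) ≤ 2 * A := by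
  rw [← Finset.sum_range_reflect]
  refine sum_ite_le_of_doubling (η := fun k => η (m + 1 - 1 - k)) (fun k => P (m + 1 - 1 - k))
    (fun k hk => ?_) fun k hk hP => hA _ (by omega) hP
  have h1 := h (m + 1 - 1 - (k + 1)) (by omega)
  have h2 : m + 1 - 1 - (k + 1) + 1 = m + 1 - 1 - k := by omega
  rwa [h2] at h1

/-- A bound valid for all simultaneous choices bounds the sum of the suprema. -/
lemma sum_iSup_le_of_forall {ι κ : Type*} [Nonempty κ] (s : Finset ι) (g : ι → κ → ℝ≥0∞) (K : ℝ≥0∞)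
    (h : ∀ c : ι → κ, ∑ i ∈ s, g i (c i) ≤ K) : ∑ i ∈ s, ⨆ k, g i k ≤ K := by
  classical
  suffices H : ∀ A : ℝ≥0∞, (∀ c : ι → κ, A + ∑ i ∈ s, g i (c i) ≤ K) →
      A + ∑ i ∈ s, ⨆ k, g i k ≤ K by simpa using H 0 (by simpa using h)
  clear h
  induction s using Finset.induction_on with
  | empty => intro A h; simpa using h (fun _ => Classical.arbitrary κ)
  | insert a s ha ih =>
    intro A h
    rw [Finset.sum_insert ha, ← add_assoc, ENNReal.add_iSup, ENNReal.iSup_add]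
    refine iSup_le fun k => ih _ fun c => ?_
    have := h (Function.update c a k)
    rw [Finset.sum_insert ha, ← add_assoc, Function.update_self] at this
    refine le_trans (le_of_eq ?_) this
    congr 1
    refine Finset.sum_congr rfl fun i hi => ?_
    rw [Function.update_of_ne (by rintro rfl; exact ha hi)]

/-! ### Discretizing sequences -/

/-- A pair of positive, finite and continuous functions on `(0, ∞)`, the first non-decreasing
and the second decreasing to zero. -/
structure IsProfile (h u : ℝ → ℝ≥0∞) : Prop where
  mono : MonotoneOn h (Ioi 0)
  anti : AntitoneOn u (Ioi 0)
  h_pos : ∀ t, 0 < t → 0 < h t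
  h_lt_top : ∀ t, 0 < t → h t < ∞
  u_pos : ∀ t, 0 < t → 0 < u t
  u_lt_top : ∀ t, 0 < t → u t < ∞
  h_cont : ContinuousOn h (Ioi 0)
  u_cont : ContinuousOn u (Ioi 0)
  u_tendsto : Tendsto u atTop (𝓝 0)

/-- Points `x 0 ≤ z 0 ≤ x 1 ≤ z 1 ≤ ⋯ ≤ x m` such that `h` grows by the factor `a` on each
`[x k, z k]`, `u` decays by the factor `a` on each `[z k, x (k + 1)]`, and `h` grows by at most
the factor `a` between `x m` and `N`. -/
structure IsDiscretization (h u : ℝ → ℝ≥0∞) (a : ℝ≥0∞) (N : ℝ) (m : ℕ) (x z : ℕ → ℝ) : Prop where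
  zero_lt : 0 < x 0
  le_mid : ∀ k < m, x k ≤ z k
  mid_le : ∀ k < m, z k ≤ x (k + 1)
  h_mid : ∀ k < m, h (z k) = a * h (x k)
  u_mid : ∀ k < m, u (z k) = a * u (x (k + 1))
  last : h N ≤ a * h (x m)

variable {h u : ℝ → ℝ≥0∞} {a : ℝ≥0∞}

lemma IsProfile.exists_step (H : IsProfile h u) (ha : 1 ≤ a) (ha' : a ≠ ∞) {x N : ℝ} (hx : 0 < x)
    (hxN : x ≤ N) (hN : a * h x ≤ h N) :
    ∃ z y, x ≤ z ∧ z ≤ y ∧ h z = a * h x ∧ u z = a * u y := by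
  have ha0 : a ≠ 0 := (zero_lt_one.trans_le ha).ne'
  obtain ⟨z, hz, hzh⟩ : a * h x ∈ h '' Icc x N :=
    intermediate_value_Icc hxN (H.h_cont.mono fun s hs => hx.trans_le hs.1)
      ⟨le_mul_of_one_le_left zero_le ha, hN⟩
  have hz0 : 0 < z := hx.trans_le hz.1
  have hlt : 0 < u z / a := ENNReal.div_pos (H.u_pos z hz0).ne' ha'
  obtain ⟨y₀, hy₀, hzy₀⟩ := ((H.u_tendsto.eventually (eventually_lt_nhds hlt)).and
    (eventually_ge_atTop z)).exists
  obtain ⟨y, hy, hyu⟩ : u z / a ∈ u '' Icc z y₀ :=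
    intermediate_value_Icc' hzy₀ (H.u_cont.mono fun s hs => hz0.trans_le hs.1)
      ⟨hy₀.le, ENNReal.div_le_of_le_mul (le_mul_of_one_le_right zero_le ha)⟩
  exact ⟨z, y, hz.1, hy.1, hzh, by rw [hyu, ENNReal.mul_div_cancel ha0 ha']⟩

/-- Alternating between a growth of `h` and a decay of `u` by the factor `a` exhausts `[ε, N]`
after finitely many steps. -/
theorem IsProfile.exists_isDiscretization (H : IsProfile h u) (ha : 1 < a) (ha' : a ≠ ∞)
    {ε N : ℝ} (hε : 0 < ε) (hN : 0 < N) :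
    ∃ m x z, x 0 = ε ∧ IsDiscretization h u a N m x z := by
  have main : ∀ M : ℕ, ∀ ε : ℝ, 0 < ε → h N ≤ a ^ M * (a * h ε) →
      ∃ m x z, x 0 = ε ∧ IsDiscretization h u a N m x z := by
    intro M
    induction M with
    | zero =>
      intro ε hε hM
      exact ⟨0, fun _ => ε, fun _ => ε, rfl, hε, by simp, by simp, by simp, by simp,
        by simpa using hM⟩
    | succ M ih =>
      intro ε hε hM
      by_cases hc : h N ≤ a * h ε
      · exact ⟨0, fun _ => ε, fun _ => ε, rfl, hε, by simp, by simp, by simp, by simp, hc⟩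
      have hεN : ε ≤ N := by
        by_contra hcon
        exact hc ((H.mono hN hε (not_le.1 hcon).le).trans
          (le_mul_of_one_le_left zero_le ha.le))
      obtain ⟨z₀, y, hz, hy, hzh, hyu⟩ := H.exists_step ha.le ha' hε hεN (not_le.1 hc).le
      have hz0 := hε.trans_le hz
      have hy0 := hz0.trans_le hy
      obtain ⟨m, x, z, hx0, hD⟩ := ih y hy0 <| by
        calc h N ≤ a ^ (M + 1) * (a * h ε) := hM
          _ = a ^ M * (a * h z₀) := by rw [hzh]; ring
          _ ≤ _ := by gcongr; exact H.mono hz0 hy0 hy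
      refine ⟨m + 1, fun k => Nat.casesOn k ε x, fun k => Nat.casesOn k z₀ z, rfl, hε, ?_, ?_, ?_,
        ?_, hD.last⟩
      · rintro (_ | k) hk
        · exact hz
        · exact hD.le_mid k (by omega)
      · rintro (_ | k) hk
        · simpa [hx0] using hy
        · exact hD.mid_le k (by omega)
      · rintro (_ | k) hk
        · exact hzh
        · exact hD.h_mid k (by omega)
      · rintro (_ | k) hk
        · simpa [hx0] using hyu
        · exact hD.u_mid k (by omega)
  have ht : Tendsto (fun M : ℕ => a ^ M) atTop (𝓝 ∞) :=
    ENNReal.tendsto_pow_atTop_nhds_top_iff.2 ha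
  have hne : h ε ≠ 0 := (H.h_pos ε hε).ne'
  have hlt : h N / h ε < ∞ := ENNReal.div_lt_top (H.h_lt_top N hN).ne hne
  obtain ⟨M, hM⟩ := (ht.eventually (eventually_gt_nhds hlt)).exists
  refine main M ε hε ?_
  calc h N = h N / h ε * h ε := (ENNReal.div_mul_cancel hne (H.h_lt_top ε hε).ne).symm
    _ ≤ a ^ M * (a * h ε) := by
        gcongr
        exact le_mul_of_one_le_left zero_le ha.le

namespace IsDiscretization

variable {N : ℝ} {m : ℕ} {x z : ℕ → ℝ}

lemma le_succ (hD : IsDiscretization h u a N m x z) {k : ℕ} (hk : k < m) : x k ≤ x (k + 1) :=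
  (hD.le_mid k hk).trans (hD.mid_le k hk)

lemma le_of_le (hD : IsDiscretization h u a N m x z) {i j : ℕ} (hij : i ≤ j) (hj : j ≤ m) :
    x i ≤ x j := by
  induction j, hij using Nat.le_induction with
  | base => exact le_rfl
  | succ j _ ih => exact (ih (by omega)).trans (hD.le_succ (by omega))

lemma pos (hD : IsDiscretization h u a N m x z) {k : ℕ} (hk : k ≤ m) : 0 < x k :=
  hD.zero_lt.trans_le (hD.le_of_le (Nat.zero_le k) hk)

lemma mid_pos (hD : IsDiscretization h u a N m x z) {k : ℕ} (hk : k < m) : 0 < z k :=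
  (hD.pos hk.le).trans_le (hD.le_mid k hk)

lemma h_succ (hD : IsDiscretization h u a N m x z) (H : IsProfile h u) {k : ℕ} (hk : k < m) :
    a * h (x k) ≤ h (x (k + 1)) := by
  rw [← hD.h_mid k hk]
  exact H.mono (hD.mid_pos hk) (hD.pos hk) (hD.mid_le k hk)

lemma u_succ (hD : IsDiscretization h u a N m x z) (H : IsProfile h u) {k : ℕ} (hk : k < m) :
    a * u (x (k + 1)) ≤ u (x k) := by
  rw [← hD.u_mid k hk]
  exact H.anti (hD.pos hk.le) (hD.mid_pos hk) (hD.le_mid k hk)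

end IsDiscretization

end

section

/-! ### The fundamental function of a representation measure -/

/-- The scale `t ↦ μ (-∞, t) ^ α` with respect to which measures are represented. -/
noncomputable def scale (μ : Measure ℝ) (α : ℝ) (t : ℝ) : ℝ≥0∞ := μ (Iio t) ^ α

/-- The quotient of the fundamental function of `ν` by the scale. -/
noncomputable def decay (μ : Measure ℝ) (α : ℝ) (ν : Measure ℝ≥0) (t : ℝ) : ℝ≥0∞ :=
  ∫⁻ s : ℝ≥0, (scale μ α s + scale μ α t)⁻¹ ∂ν

variable {μ ω : Measure ℝ} {α : ℝ} {ν : Measure ℝ≥0}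

lemma fundamentalFunction_eq (t : ℝ) :
    fundamentalFunction (scale μ α) ν t = scale μ α t * decay μ α ν t := rfl

lemma scale_mono (hα : 0 < α) : Monotone (scale μ α) := fun _ _ h =>
  ENNReal.rpow_le_rpow (measure_mono (Iio_subset_Iio h)) hα.le

lemma measurable_scale (hα : 0 < α) : Measurable fun s : ℝ≥0 => scale μ α (s : ℝ) :=
  Monotone.measurable fun _ _ h => scale_mono hα (NNReal.coe_le_coe.2 h)

lemma scale_ne_top (hμ : IsClock μ) (hα : 0 < α) (t : ℝ) : scale μ α t ≠ ∞ :=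
  ENNReal.rpow_ne_top_of_nonneg hα.le (hμ.lt_top t).ne

lemma scale_pos (hμ : IsClock μ) {t : ℝ} (ht : 0 < t) : 0 < scale μ α t :=
  ENNReal.rpow_pos (hμ.pos t ht) (hμ.lt_top t).ne

lemma continuous_scale (hμ : IsClock μ) : Continuous (scale μ α) :=
  ENNReal.continuous_rpow_const.comp hμ.continuous

lemma tendsto_scale (hμ : IsClock μ) (hα : 0 < α) : Tendsto (scale μ α) atTop (𝓝 ∞) := by
  have h := (ENNReal.continuous_rpow_const (y := α)).tendsto ∞
  rw [ENNReal.top_rpow_of_pos hα] at h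
  exact h.comp hμ.tendsto_atTop

lemma measurable_inv_scale_add (hα : 0 < α) (t : ℝ) :
    Measurable fun s : ℝ≥0 => (scale μ α s + scale μ α t)⁻¹ :=
  ((measurable_scale hα).add_const _).inv

lemma mul_inv_add_le {A B S : ℝ≥0∞} (h : A ≤ B) (hA : A ≠ 0) (hB : B ≠ ∞) (hS : S ≠ ∞) :
    A * (S + A)⁻¹ ≤ B * (S + B)⁻¹ := by
  have hA' : A ≠ ∞ := ne_top_of_le_ne_top hB h
  have hB' : B ≠ 0 := fun h' => hA (by simpa [h'] using h)
  rw [← div_eq_mul_inv, ← div_eq_mul_inv, ENNReal.div_le_iff (by simp [hA]) (by simp [hS, hA']),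
    ← ENNReal.mul_div_right_comm, ENNReal.le_div_iff_mul_le (by simp [hB']) (by simp [hS, hB])]
  rw [mul_add, mul_add, mul_comm A B]
  gcongr

lemma mul_inv_add_le_one (A S : ℝ≥0∞) : A * (S + A)⁻¹ ≤ 1 := by
  rw [← div_eq_mul_inv]
  exact ENNReal.div_le_of_le_mul (by rw [one_mul]; exact le_add_self)

lemma one_le_two_mul_mul_inv_add {A S : ℝ≥0∞} (h : S ≤ A) (hA : A ≠ 0) (hA' : A ≠ ∞) :
    1 ≤ 2 * (A * (S + A)⁻¹) := by
  rw [← mul_assoc, ← div_eq_mul_inv,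
    ENNReal.le_div_iff_mul_le (by simp [hA]) (by simp [hA', ne_top_of_le_ne_top hA' h]), one_mul,
    two_mul]
  gcongr

lemma inv_le_two_mul_inv_add {A S : ℝ≥0∞} (h : A ≤ S) : S⁻¹ ≤ 2 * (S + A)⁻¹ := by
  have : S + A ≤ 2 * S := by rw [two_mul]; gcongr
  calc S⁻¹ = 2 * (2 * S)⁻¹ := by
        rw [ENNReal.mul_inv (by simp) (by simp), ← mul_assoc, ENNReal.mul_inv_cancel (by simp)
          (by simp), one_mul]
    _ ≤ _ := by gcongr

theorem isProfile_fundamentalFunction (hμ : IsClock μ) (hα : 0 < α)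
    (hν : ∀ t, 0 < t → 0 < fundamentalFunction (scale μ α) ν t ∧
      fundamentalFunction (scale μ α) ν t < ∞) :
    IsProfile (fundamentalFunction (scale μ α) ν) (decay μ α ν) := by
  have hpos : ∀ t, 0 < t → 0 < decay μ α ν t := fun t ht => by
    by_contra hcon
    have h0 : decay μ α ν t = 0 := by simpa using hcon
    exact (hν t ht).1.ne' (by rw [fundamentalFunction_eq, h0, mul_zero])
  have hfin : ∀ t, 0 < t → decay μ α ν t < ∞ := fun t ht => by
    by_contra hcon
    have h0 : decay μ α ν t = ∞ := by simpa using hcon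
    exact (hν t ht).2.ne (by
      rw [fundamentalFunction_eq, h0, ENNReal.mul_top (scale_pos hμ ht).ne'])
  have hcont : ContinuousOn (decay μ α ν) (Ioi 0) := by
    intro t ht
    have ht : 0 < t := ht
    refine ContinuousAt.continuousWithinAt ?_
    refine tendsto_lintegral_filter_of_dominated_convergence
      (fun s : ℝ≥0 => (scale μ α s + scale μ α (t / 2))⁻¹)
      (Eventually.of_forall fun r => measurable_inv_scale_add hα r) ?_ (hfin _ (half_pos ht)).ne ?_
    · filter_upwards [eventually_gt_nhds (half_lt_self ht)] with r hr
      refine Eventually.of_forall fun s => ?_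
      gcongr
      exact scale_mono hα hr.le
    · refine Eventually.of_forall fun s => ?_
      exact (continuous_inv.comp
        (continuous_const.add (continuous_scale hμ))).continuousAt
  refine ⟨?_, ?_, fun t ht => (hν t ht).1, fun t ht => (hν t ht).2, hpos, hfin, ?_, hcont, ?_⟩
  · intro t ht t' ht' h
    rw [fundamentalFunction_eq, fundamentalFunction_eq, decay, decay,
      ← lintegral_const_mul _ (measurable_inv_scale_add hα t),
      ← lintegral_const_mul _ (measurable_inv_scale_add hα t')]
    exact lintegral_mono fun s => mul_inv_add_le (scale_mono hα h) (scale_pos hμ ht).ne'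
      (scale_ne_top hμ hα _) (scale_ne_top hμ hα _)
  · intro t ht t' ht' h
    refine lintegral_mono fun s => ?_
    gcongr
    exact scale_mono hα h
  · intro t ht
    exact ENNReal.Tendsto.mul (continuous_scale hμ).continuousWithinAt
      (Or.inr (hfin t ht).ne) (hcont t ht) (Or.inr (scale_ne_top hμ hα t))
  · have h := tendsto_lintegral_filter_of_dominated_convergence (μ := ν) (l := atTop)
      (F := fun (r : ℝ) (s : ℝ≥0) => (scale μ α s + scale μ α r)⁻¹) (f := fun _ => 0)
      (fun s : ℝ≥0 => (scale μ α s + scale μ α 1)⁻¹)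
      (Eventually.of_forall fun r => measurable_inv_scale_add hα r) ?_ (hfin _ one_pos).ne ?_
    · rw [lintegral_zero] at h
      exact h
    · filter_upwards [eventually_ge_atTop 1] with r hr
      refine Eventually.of_forall fun s => ?_
      gcongr
      exact scale_mono hα hr
    · refine Eventually.of_forall fun s => ?_
      have h1 := tendsto_const_nhds (x := scale μ α s).add (tendsto_scale hμ hα)
      rw [add_top] at h1
      have h2 := (continuous_inv.tendsto (∞ : ℝ≥0∞)).comp h1
      rwa [ENNReal.inv_top] at h2

/-- Splitting `[x 0, N)` along a discretizing sequence. The map `π` allows for measures on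
subsets of the line. -/
lemma setLIntegral_Ico_le_sum {X : Type*} [MeasurableSpace X] {ρ : Measure X} (π : X → ℝ)
    (f : X → ℝ≥0∞) {m : ℕ} {x z : ℕ → ℝ} {N : ℝ} (e : ℕ → ℝ≥0∞)
    (h1 : ∀ k < m, ∫⁻ s in π ⁻¹' Ico (x k) (z k), f s ∂ρ ≤ e k)
    (h2 : ∀ k < m, ∫⁻ s in π ⁻¹' Ico (z k) (x (k + 1)), f s ∂ρ ≤ e (k + 1))
    (h3 : ∫⁻ s in π ⁻¹' Ico (x m) N, f s ∂ρ ≤ e m) :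
    ∫⁻ s in π ⁻¹' Ico (x 0) N, f s ∂ρ ≤ 2 * ∑ k ∈ Finset.range (m + 1), e k := by
  have split : ∀ r y N' : ℝ, ∫⁻ s in π ⁻¹' Ico r N', f s ∂ρ ≤
      ∫⁻ s in π ⁻¹' Ico r y, f s ∂ρ + ∫⁻ s in π ⁻¹' Ico y N', f s ∂ρ := fun r y N' => by
    refine (lintegral_mono_set ?_).trans (lintegral_union_le _ _ _)
    rw [← preimage_union]
    exact preimage_mono Ico_subset_Ico_union_Ico
  have key : ∀ n ≤ m, ∫⁻ s in π ⁻¹' Ico (x 0) (x n), f s ∂ρ + e n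
      ≤ 2 * ∑ k ∈ Finset.range (n + 1), e k := by
    intro n
    induction n with
    | zero => intro _; simp [two_mul]
    | succ n ih =>
      intro hn
      rw [Finset.sum_range_succ, mul_add]
      calc ∫⁻ s in π ⁻¹' Ico (x 0) (x (n + 1)), f s ∂ρ + e (n + 1)
          ≤ (∫⁻ s in π ⁻¹' Ico (x 0) (x n), f s ∂ρ + (e n + e (n + 1))) + e (n + 1) := by
            gcongr
            refine (split _ (x n) _).trans ?_
            gcongr
            refine (split _ (z n) _).trans ?_
            gcongr
            · exact h1 n (by omega)
            · exact h2 n (by omega)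
        _ = (∫⁻ s in π ⁻¹' Ico (x 0) (x n), f s ∂ρ + e n) + 2 * e (n + 1) := by ring
        _ ≤ _ := by gcongr; exact ih (by omega)
  refine (split _ (x m) _).trans (le_trans ?_ (key m le_rfl))
  gcongr

/-! ### Sufficiency: splitting a function along a discretizing sequence -/

/-- Where the fundamental function is essentially constant, flattening `F` to the left of `x`
and cutting it off at `z` gives a multiple of a test function. -/
lemma setLIntegral_Ico_le_mul_gain (hα : 0 < α) {F : ℝ → ℝ≥0∞} (hF : Antitone F) {x z : ℝ}
    {c : ℝ≥0∞} (hc : c ≠ 0) (hc' : c ≠ ∞) (h : (∫⁻ s in Iio z, F s ∂μ) ^ α ≤ c) :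
    ∫⁻ s in Ico x z, F s ^ α ∂ω ≤ c * gain μ ω α x := by
  let G : ℝ → ℝ≥0∞ := fun s => if max s x < z then F (max s x) else 0
  have hG : Antitone G := by
    intro s t hst
    have h1 : max s x ≤ max t x := max_le_max_right x hst
    simp only [G]
    split_ifs with h2 h3
    · exact hF h1
    · exact absurd (h1.trans_lt h2) h3
    · simp
    · simp
  have hGm : ∫⁻ s, G s ∂μ ≤ c ^ (1 / α) := by
    calc ∫⁻ s, G s ∂μ ≤ ∫⁻ s, (Iio z).indicator F s ∂μ := by
          refine lintegral_mono fun s => ?_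
          simp only [G, indicator, mem_Iio]
          split_ifs with h1 h2
          · exact hF (le_max_left _ _)
          · exact absurd ((le_max_left _ _).trans_lt h1) h2
          · simp
          · simp
      _ = ∫⁻ s in Iio z, F s ∂μ := lintegral_indicator measurableSet_Iio _
      _ = ((∫⁻ s in Iio z, F s ∂μ) ^ α) ^ (1 / α) := by
          rw [one_div, ENNReal.rpow_rpow_inv hα.ne']
      _ ≤ _ := by gcongr
  have key := lintegral_rpow_le_gain (ω := ω) (t := x) hα hG
    (fun s hs => by simp only [G, max_eq_right hs, max_self])
    (ENNReal.rpow_pos (pos_iff_ne_zero.2 hc) hc').ne'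
    (ENNReal.rpow_ne_top_of_nonneg (by positivity) hc') hGm
  rw [one_div, ENNReal.rpow_inv_rpow hα.ne'] at key
  refine le_trans ?_ key
  refine le_trans ?_ (setLIntegral_le_lintegral (Ico x z) _)
  refine setLIntegral_mono' measurableSet_Ico fun s hs => ?_
  simp only [G, max_eq_left hs.1, if_pos hs.2, le_refl]

lemma rpow_le_decay (hμ : IsClock μ) (hα : 0 < α) {F : ℝ → ℝ≥0∞} (hF : Antitone F) {s : ℝ}
    (hs : 0 < s) (h : (∫⁻ s in Iio s, F s ∂μ) ^ α ≤ fundamentalFunction (scale μ α) ν s) :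
    F s ^ α ≤ decay μ α ν s := by
  have h1 : scale μ α s * F s ^ α ≤ scale μ α s * decay μ α ν s := by
    rw [← fundamentalFunction_eq]
    refine le_trans ?_ h
    rw [scale, mul_comm, ← ENNReal.mul_rpow_of_nonneg _ _ hα.le]
    gcongr
    exact mul_measure_le_lintegral hF s
  rwa [ENNReal.mul_le_mul_iff_right (scale_pos hμ hs).ne' (scale_ne_top hμ hα s)] at h1

/-- Where the fundamental function is essentially a multiple of the scale, `F` is dominated by
a constant. -/
lemma setLIntegral_Ico_le_mul_gain_right [NullSingletonClass μ] [NullSingletonClass ω]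
    (hμ : IsClock μ) (hα : 0 < α) {F : ℝ → ℝ≥0∞} (hF : Antitone F) {z y : ℝ} (hz : 0 < z)
    (hy : 0 < y) (h : (∫⁻ s in Iio z, F s ∂μ) ^ α ≤ fundamentalFunction (scale μ α) ν z)
    {a : ℝ≥0∞} (hu : decay μ α ν z ≤ a * decay μ α ν y) :
    ∫⁻ s in Ico z y, F s ^ α ∂ω
      ≤ a * (fundamentalFunction (scale μ α) ν y * gain μ ω α y) := by
  calc ∫⁻ s in Ico z y, F s ^ α ∂ω ≤ ∫⁻ s in Ico z y, a * decay μ α ν y ∂ω := by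
        refine setLIntegral_mono' measurableSet_Ico fun s hs => ?_
        refine le_trans ?_ ((rpow_le_decay hμ hα hF hz h).trans hu)
        gcongr
        exact hF hs.1
    _ ≤ a * decay μ α ν y * ω (Iio y) := by
        rw [setLIntegral_const]
        gcongr
        exact fun s hs => hs.2
    _ ≤ a * decay μ α ν y * (scale μ α y * gain μ ω α y) := by
        gcongr
        exact measure_le_gain hμ hα hy le_rfl
    _ = _ := by rw [fundamentalFunction_eq]; ring

/-- Since the gain decreases and its product with the scale is essentially increasing, the gain at `x`
is dominated by the gain at `s`, up to the damping factor occurring in the fundamental function. -/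
lemma gain_mul_le [NullSingletonClass μ] (hμ : IsClock μ) (hα : 0 < α) {x s : ℝ} (hx : 0 < x) :
    gain μ ω α x * (scale μ α x * (scale μ α s + scale μ α x)⁻¹) ≤ 2 ^ α * gain μ ω α s := by
  have h2 : (1 : ℝ≥0∞) ≤ 2 ^ α := ENNReal.one_le_rpow (by simp) hα
  rcases le_total s x with h | h
  · calc gain μ ω α x * (scale μ α x * (scale μ α s + scale μ α x)⁻¹)
        ≤ gain μ ω α s * 1 := by
          gcongr
          · exact gain_antitone h
          · exact mul_inv_add_le_one _ _
      _ ≤ _ := by rw [mul_comm]; gcongr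
  · calc gain μ ω α x * (scale μ α x * (scale μ α s + scale μ α x)⁻¹)
        = (scale μ α x * gain μ ω α x) * (scale μ α x + scale μ α s)⁻¹ := by
          rw [add_comm (scale μ α s)]; ring
      _ ≤ (2 ^ α * (scale μ α s * gain μ ω α s)) * (scale μ α x + scale μ α s)⁻¹ := by
          gcongr ?_ * _
          exact rpow_mul_gain_le hμ hα hx h
      _ = 2 ^ α * gain μ ω α s * (scale μ α s * (scale μ α x + scale μ α s)⁻¹) := by ring
      _ ≤ 2 ^ α * gain μ ω α s * 1 := by gcongr; exact mul_inv_add_le_one _ _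
      _ = _ := mul_one _

/-- If at least half of the fundamental function at `x` comes from the part of `ν` on `J`,
then the product of the fundamental function and the gain is controlled by the integral of the
gain over `J`. -/
lemma fundamentalFunction_mul_gain_le [NullSingletonClass μ] (hμ : IsClock μ) (hα : 0 < α) {x : ℝ}
    (hx : 0 < x) (hfin : fundamentalFunction (scale μ α) ν x < ∞) {J : Set ℝ≥0}
    (hJ : MeasurableSet J)
    (h : ∫⁻ s in Jᶜ, scale μ α x * (scale μ α s + scale μ α x)⁻¹ ∂ν
      ≤ fundamentalFunction (scale μ α) ν x / 2) :
    fundamentalFunction (scale μ α) ν x * gain μ ω α x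
      ≤ 2 * 2 ^ α * ∫⁻ s in J, gain μ ω α s ∂ν := by
  have hm : Measurable fun s : ℝ≥0 => scale μ α x * (scale μ α s + scale μ α x)⁻¹ :=
    (measurable_inv_scale_add hα x).const_mul _
  set A := fundamentalFunction (scale μ α) ν x with hA
  have h1 : A = ∫⁻ s in J, scale μ α x * (scale μ α s + scale μ α x)⁻¹ ∂ν
      + ∫⁻ s in Jᶜ, scale μ α x * (scale μ α s + scale μ α x)⁻¹ ∂ν := by
    rw [lintegral_add_compl _ hJ, lintegral_const_mul _ (measurable_inv_scale_add hα x)]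
    rfl
  have h2 : A ≤ 2 * ∫⁻ s in J, scale μ α x * (scale μ α s + scale μ α x)⁻¹ ∂ν := by
    have h3 : A / 2 + A / 2
        ≤ ∫⁻ s in J, scale μ α x * (scale μ α s + scale μ α x)⁻¹ ∂ν + A / 2 := by
      rw [ENNReal.add_halves]
      conv_lhs => rw [h1]
      gcongr
    have h4 := (ENNReal.add_le_add_iff_right (ENNReal.div_ne_top hfin.ne (by simp))).1 h3
    calc A = 2 * (A / 2) := (ENNReal.mul_div_cancel (by simp) (by simp)).symm
      _ ≤ _ := by gcongr
  calc A * gain μ ω α x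
      ≤ 2 * (∫⁻ s in J, scale μ α x * (scale μ α s + scale μ α x)⁻¹ ∂ν) * gain μ ω α x := by gcongr
    _ = 2 * ∫⁻ s in J, gain μ ω α x * (scale μ α x * (scale μ α s + scale μ α x)⁻¹) ∂ν := by
        rw [lintegral_const_mul _ hm]; ring
    _ ≤ 2 * ∫⁻ s in J, 2 ^ α * gain μ ω α s ∂ν := by
        gcongr 2 * ?_
        exact lintegral_mono fun s => gain_mul_le hμ hα hx
    _ = _ := by
        rw [lintegral_const_mul' _ _ (ENNReal.rpow_ne_top_of_nonneg hα.le (by simp)), mul_assoc]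

/-- If the fundamental function grows by a factor `8` from `y` to `x`, then the part of `ν` to the
left of `y` contributes at most a quarter of its value at `x`. -/
lemma setLIntegral_lt_le (hμ : IsClock μ) (hα : 0 < α) {x y : ℝ} (hy : 0 < y)
    (h : 8 * fundamentalFunction (scale μ α) ν y ≤ fundamentalFunction (scale μ α) ν x) :
    ∫⁻ s in {s : ℝ≥0 | (s : ℝ) < y}, scale μ α x * (scale μ α s + scale μ α x)⁻¹ ∂ν
      ≤ fundamentalFunction (scale μ α) ν x / 2 / 2 := by
  rw [ENNReal.le_div_iff_mul_le (by simp) (by simp), ENNReal.le_div_iff_mul_le (by simp) (by simp),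
    mul_assoc, mul_comm, show (2 : ℝ≥0∞) * 2 = 4 by norm_num]
  refine le_trans ?_ h
  calc 4 * ∫⁻ s in {s : ℝ≥0 | (s : ℝ) < y}, scale μ α x * (scale μ α s + scale μ α x)⁻¹ ∂ν
      ≤ 4 * ∫⁻ s in {s : ℝ≥0 | (s : ℝ) < y},
          2 * scale μ α y * (scale μ α s + scale μ α y)⁻¹ ∂ν := by
        gcongr 4 * ?_
        refine setLIntegral_mono' (measurableSet_lt (by fun_prop) (by fun_prop)) fun s hs => ?_
        refine (mul_inv_add_le_one _ _).trans ?_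
        rw [mul_assoc]
        exact one_le_two_mul_mul_inv_add (scale_mono hα (le_of_lt hs)) (scale_pos hμ hy).ne'
          (scale_ne_top hμ hα y)
    _ ≤ 4 * ∫⁻ s : ℝ≥0, 2 * scale μ α y * (scale μ α s + scale μ α y)⁻¹ ∂ν := by
        gcongr
        exact Measure.restrict_le_self
    _ = 8 * fundamentalFunction (scale μ α) ν y := by
        rw [lintegral_const_mul _ (measurable_inv_scale_add hα y), fundamentalFunction_eq, decay]
        ring

/-- If the decay function drops by a factor `8` from `x` to `y`, then the part of `ν` to the right
of `y` contributes at most a quarter of the fundamental function at `x`. -/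
lemma setLIntegral_ge_le (hα : 0 < α) {x y : ℝ}
    (h : 8 * decay μ α ν y ≤ decay μ α ν x) :
    ∫⁻ s in {s : ℝ≥0 | y ≤ (s : ℝ)}, scale μ α x * (scale μ α s + scale μ α x)⁻¹ ∂ν
      ≤ fundamentalFunction (scale μ α) ν x / 2 / 2 := by
  rw [ENNReal.le_div_iff_mul_le (by simp) (by simp), ENNReal.le_div_iff_mul_le (by simp) (by simp),
    mul_assoc, mul_comm, show (2 : ℝ≥0∞) * 2 = 4 by norm_num]
  calc 4 * ∫⁻ s in {s : ℝ≥0 | y ≤ (s : ℝ)}, scale μ α x * (scale μ α s + scale μ α x)⁻¹ ∂ν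
      ≤ 4 * ∫⁻ s in {s : ℝ≥0 | y ≤ (s : ℝ)},
          scale μ α x * (2 * (scale μ α s + scale μ α y)⁻¹) ∂ν := by
        gcongr 4 * ?_
        refine setLIntegral_mono' (measurableSet_le (by fun_prop) (by fun_prop)) fun s hs => ?_
        gcongr
        exact (ENNReal.inv_le_inv.2 le_self_add).trans
          (inv_le_two_mul_inv_add (scale_mono hα hs))
    _ ≤ 4 * ∫⁻ s : ℝ≥0, scale μ α x * (2 * (scale μ α s + scale μ α y)⁻¹) ∂ν := by
        gcongr
        exact Measure.restrict_le_self
    _ = scale μ α x * (8 * decay μ α ν y) := by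
        rw [lintegral_const_mul _ ((measurable_inv_scale_add hα y).const_mul _),
          lintegral_const_mul _ (measurable_inv_scale_add hα y), decay]
        ring
    _ ≤ _ := by rw [fundamentalFunction_eq]; gcongr

/-- Along a discretizing sequence most of the fundamental function at `x k` comes from the part
of `ν` between the neighbouring points, and these intervals overlap at most twice. -/
theorem sum_fundamentalFunction_mul_gain_le [NullSingletonClass μ] (hμ : IsClock μ) (hα : 0 < α)
    (H : IsProfile (fundamentalFunction (scale μ α) ν) (decay μ α ν)) {a : ℝ≥0∞} (ha : 8 ≤ a)
    {N : ℝ} {m : ℕ} {x z : ℕ → ℝ}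
    (hD : IsDiscretization (fundamentalFunction (scale μ α) ν) (decay μ α ν) a N m x z) :
    ∑ k ∈ Finset.range (m + 1), fundamentalFunction (scale μ α) ν (x k) * gain μ ω α (x k)
      ≤ 3 * (2 * 2 ^ α) * ∫⁻ s : ℝ≥0, gain μ ω α s ∂ν := by
  set A := fundamentalFunction (scale μ α) ν
  set c : ℝ≥0∞ := 2 * 2 ^ α
  have hlt : ∀ r : ℝ, MeasurableSet {s : ℝ≥0 | (s : ℝ) < r} := fun r =>
    measurableSet_lt (by fun_prop) (by fun_prop)
  have hge : ∀ r : ℝ, MeasurableSet {s : ℝ≥0 | r ≤ (s : ℝ)} := fun r =>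
    measurableSet_le (by fun_prop) (by fun_prop)
  have left : ∀ k < m, ∫⁻ s in {s : ℝ≥0 | (s : ℝ) < x k},
      scale μ α (x (k + 1)) * (scale μ α s + scale μ α (x (k + 1)))⁻¹ ∂ν ≤ A (x (k + 1)) / 2 / 2 :=
    fun k hk => setLIntegral_lt_le hμ hα (hD.pos hk.le)
      (le_trans (by gcongr) (hD.h_succ H hk))
  have right : ∀ k < m, ∫⁻ s in {s : ℝ≥0 | x (k + 1) ≤ (s : ℝ)},
      scale μ α (x k) * (scale μ α s + scale μ α (x k))⁻¹ ∂ν ≤ A (x k) / 2 / 2 :=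
    fun k hk => setLIntegral_ge_le hα (le_trans (by gcongr) (hD.u_succ H hk))
  have quarter : ∀ B : ℝ≥0∞, B / 2 / 2 ≤ B / 2 := fun B => ENNReal.half_le_self
  have key : ∀ n < m, ∑ k ∈ Finset.range (n + 1), A (x k) * gain μ ω α (x k)
      ≤ c * (∫⁻ s in {s : ℝ≥0 | (s : ℝ) < x n}, gain μ ω α s ∂ν
        + ∫⁻ s in {s : ℝ≥0 | (s : ℝ) < x (n + 1)}, gain μ ω α s ∂ν) := by
    intro n
    induction n with
    | zero =>
      intro hm
      rw [zero_add, Finset.sum_range_one]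
      refine (fundamentalFunction_mul_gain_le hμ hα hD.zero_lt (H.h_lt_top _ hD.zero_lt)
        (hlt (x 1)) ?_).trans (by gcongr; exact le_add_self)
      have : {s : ℝ≥0 | (s : ℝ) < x 1}ᶜ = {s : ℝ≥0 | x 1 ≤ (s : ℝ)} := by ext; simp
      rw [this]
      exact (right 0 hm).trans (quarter _)
    | succ n ih =>
      intro hn
      have hle : x n ≤ x (n + 2) := hD.le_of_le (by omega) (by omega)
      have hdis : Disjoint {s : ℝ≥0 | (s : ℝ) < x n}
          ({s : ℝ≥0 | x n ≤ (s : ℝ)} ∩ {s : ℝ≥0 | (s : ℝ) < x (n + 2)}) :=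
        disjoint_left.2 fun s (h1 : (s : ℝ) < x n) h2 => absurd h2.1 (not_le.2 h1)
      have hun : {s : ℝ≥0 | (s : ℝ) < x n} ∪
          ({s : ℝ≥0 | x n ≤ (s : ℝ)} ∩ {s : ℝ≥0 | (s : ℝ) < x (n + 2)})
          = {s : ℝ≥0 | (s : ℝ) < x (n + 2)} := by
        ext s
        simp only [mem_union, mem_inter_iff, mem_ofPred_eq]
        constructor
        · rintro (h | h)
          · exact h.trans_le hle
          · exact h.2
        · intro h
          rcases lt_or_ge (s : ℝ) (x n) with h' | h'
          · exact Or.inl h'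
          · exact Or.inr ⟨h', h⟩
      have hun' := lintegral_union (μ := ν) (f := fun s : ℝ≥0 => gain μ ω α s)
        ((hge (x n)).inter (hlt (x (n + 2)))) hdis
      rw [hun] at hun'
      have hpos := hD.pos (show n + 1 ≤ m by omega)
      have step := fundamentalFunction_mul_gain_le (ω := ω) hμ hα hpos (H.h_lt_top _ hpos)
        (J := {s : ℝ≥0 | x n ≤ (s : ℝ)} ∩ {s : ℝ≥0 | (s : ℝ) < x (n + 2)})
        ((hge _).inter (hlt _)) (by
          have : ({s : ℝ≥0 | x n ≤ (s : ℝ)} ∩ {s : ℝ≥0 | (s : ℝ) < x (n + 2)})ᶜ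
              = {s : ℝ≥0 | (s : ℝ) < x n} ∪ {s : ℝ≥0 | x (n + 2) ≤ (s : ℝ)} := by
            ext s; simp only [compl_inter, mem_union, mem_compl_iff, mem_ofPred_eq, not_le, not_lt]
          rw [this]
          refine (lintegral_union_le _ _ _).trans
            ((add_le_add (left n (by omega)) (right (n + 1) hn)).trans ?_)
          rw [ENNReal.add_halves])
      rw [Finset.sum_range_succ]
      refine (add_le_add (ih (by omega)) step).trans ?_
      rw [← mul_add, show n + 1 + 1 = n + 2 from rfl, hun']
      exact le_of_eq (by ring)
  have hm := hD.pos (le_refl m)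
  rcases Nat.eq_zero_or_pos m with h0 | h0
  · subst h0
    rw [zero_add, Finset.sum_range_one]
    refine (fundamentalFunction_mul_gain_le hμ hα hm (H.h_lt_top _ hm)
      MeasurableSet.univ (by simp)).trans ?_
    rw [Measure.restrict_univ, mul_assoc 3]
    exact le_mul_of_one_le_left zero_le (by norm_num)
  · obtain ⟨n, rfl⟩ : ∃ n, m = n + 1 := ⟨m - 1, by omega⟩
    have last := fundamentalFunction_mul_gain_le (ω := ω) hμ hα hm (H.h_lt_top _ hm) (hge (x n)) (by
      have : {s : ℝ≥0 | x n ≤ (s : ℝ)}ᶜ = {s : ℝ≥0 | (s : ℝ) < x n} := by ext; simp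
      rw [this]
      exact (left n (by omega)).trans (quarter _))
    rw [Finset.sum_range_succ]
    calc _ ≤ c * (∫⁻ s : ℝ≥0, gain μ ω α s ∂ν + ∫⁻ s : ℝ≥0, gain μ ω α s ∂ν)
          + c * ∫⁻ s : ℝ≥0, gain μ ω α s ∂ν := by
          refine add_le_add ((key n (by omega)).trans ?_) (last.trans ?_)
          · gcongr <;> exact Measure.restrict_le_self
          · gcongr; exact Measure.restrict_le_self
      _ = _ := by ring

end

section

variable {μ ω : Measure ℝ} {α : ℝ} {ν : Measure ℝ≥0}

lemma setLIntegral_Ioi_le_of_forall_Ico {X : Type*} [MeasurableSpace X] {ρ : Measure X}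
    (π : X → ℝ) (f : X → ℝ≥0∞) (K : ℝ≥0∞)
    (h : ∀ ε N : ℝ, 0 < ε → 0 < N → ∫⁻ s in π ⁻¹' Ico ε N, f s ∂ρ ≤ K) :
    ∫⁻ s in π ⁻¹' Ioi 0, f s ∂ρ ≤ K := by
  have hU : Ioi (0 : ℝ) = ⋃ n : ℕ, Ico (1 / ((n : ℝ) + 1)) ((n : ℝ) + 1) := by
    ext s
    simp only [mem_Ioi, mem_iUnion, mem_Ico]
    constructor
    · intro hs
      obtain ⟨n, hn⟩ := exists_nat_one_div_lt hs
      obtain ⟨k, hk⟩ := exists_nat_gt s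
      refine ⟨max n k, le_trans ?_ hn.le, hk.trans_le ?_⟩
      · gcongr; exact le_max_left _ _
      · exact (Nat.cast_le.2 (le_max_right n k)).trans (by linarith)
    · rintro ⟨n, h1, -⟩
      exact lt_of_lt_of_le (by positivity) h1
  have hd : Directed (· ⊆ ·) fun n : ℕ => π ⁻¹' Ico (1 / ((n : ℝ) + 1)) ((n : ℝ) + 1) := by
    refine Monotone.directed_le fun n k hnk => preimage_mono (Ico_subset_Ico ?_ ?_)
    · gcongr
    · gcongr
  rw [hU, preimage_iUnion, setLIntegral_iUnion_of_directed _ hd]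
  exact iSup_le fun n => h _ _ (by positivity) (by positivity)

lemma restrict_Ioi_of_null (hω : ω (Iic 0) = 0) : ω.restrict (Ioi 0) = ω := by
  refine Measure.restrict_eq_self_of_ae_mem ?_
  rw [ae_iff]
  simpa [Iic] using hω

/-- A ratio for discretizing sequences: `8` makes the contributions to `ν` localize, and `2 ^ α` makes
the `α`-th roots of the fundamental function double. -/
lemma exists_ratio (α : ℝ) :
    ∃ a : ℝ≥0∞, 8 ≤ a ∧ 2 ^ α ≤ a ∧ a ≠ ∞ :=
  ⟨8 + 2 ^ α, le_self_add, le_add_self,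
    ENNReal.add_ne_top.2 ⟨by simp, ENNReal.rpow_ne_top_of_ne_zero (by simp) (by simp)⟩⟩

/-- If the integral of the gain against the representation measure is finite, then it controls
the integral of `F ^ α` for each non-increasing `F` obeying the growth condition. -/
theorem exists_lintegral_rpow_le [NullSingletonClass μ] [NullSingletonClass ω] (hμ : IsClock μ)
    (hω : ω (Iic 0) = 0) (hα : 0 < α)
    (hν : ∀ t, 0 < t → 0 < fundamentalFunction (scale μ α) ν t ∧
      fundamentalFunction (scale μ α) ν t < ∞) :
    ∃ C : ℝ≥0∞, C ≠ ∞ ∧ ∀ F : ℝ → ℝ≥0∞, Antitone F →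
      (∀ r, 0 < r → (∫⁻ s in Iio r, F s ∂μ) ^ α ≤ fundamentalFunction (scale μ α) ν r) →
      ∫⁻ s, F s ^ α ∂ω ≤ C * ∫⁻ s : ℝ≥0, gain μ ω α s ∂ν := by
  obtain ⟨a, ha8, -, hat⟩ := exists_ratio α
  have H := isProfile_fundamentalFunction hμ hα hν
  have ha1 : 1 < a := lt_of_lt_of_le (by norm_num) ha8
  have ha0 : a ≠ 0 := (zero_lt_one.trans ha1).ne'
  refine ⟨2 * (a * (3 * (2 * 2 ^ α))), ?_, fun F hF hFr => ?_⟩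
  · have : (2 : ℝ≥0∞) ^ α ≠ ∞ := ENNReal.rpow_ne_top_of_ne_zero (by simp) (by simp)
    finiteness
  have main : ∀ ε N : ℝ, 0 < ε → 0 < N → ∫⁻ s in id ⁻¹' Ico ε N, F s ^ α ∂ω
      ≤ 2 * (a * (3 * (2 * 2 ^ α))) * ∫⁻ s : ℝ≥0, gain μ ω α s ∂ν := by
    intro ε N hε hN
    obtain ⟨m, x, z, rfl, hD⟩ := H.exists_isDiscretization ha1 hat hε hN
    have hpos : ∀ k ≤ m, a * fundamentalFunction (scale μ α) ν (x k) ≠ 0 := fun k hk =>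
      mul_ne_zero ha0 (hν _ (hD.pos hk)).1.ne'
    have hfin : ∀ k ≤ m, a * fundamentalFunction (scale μ α) ν (x k) ≠ ∞ := fun k hk =>
      ENNReal.mul_ne_top hat (hν _ (hD.pos hk)).2.ne
    refine (setLIntegral_Ico_le_sum id (fun s => F s ^ α) (x := x) (z := z) (m := m)
      (fun k => a * (fundamentalFunction (scale μ α) ν (x k) * gain μ ω α (x k)))
      (fun k hk => ?_) (fun k hk => ?_) ?_).trans ?_
    · rw [← mul_assoc]
      exact setLIntegral_Ico_le_mul_gain hα hF (hpos k hk.le) (hfin k hk.le)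
        ((hFr _ (hD.mid_pos hk)).trans_eq (hD.h_mid k hk))
    · exact setLIntegral_Ico_le_mul_gain_right hμ hα hF (hD.mid_pos hk) (hD.pos hk)
        (hFr _ (hD.mid_pos hk)) (hD.u_mid k hk).le
    · rw [← mul_assoc]
      exact setLIntegral_Ico_le_mul_gain hα hF (hpos m le_rfl) (hfin m le_rfl)
        ((hFr _ hN).trans hD.last)
    · rw [← Finset.mul_sum, mul_assoc 2, mul_assoc a]
      gcongr
      exact sum_fundamentalFunction_mul_gain_le hμ hα H ha8 hD
  refine le_trans (le_of_eq ?_) (setLIntegral_Ioi_le_of_forall_Ico id _ _ main)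
  rw [preimage_id, restrict_Ioi_of_null hω]

/-! ### Necessity: superposing test functions along a discretizing sequence -/

/-- The integral of the gain over `[x 0, N)` is at most a multiple of the sum along the discretizing
sequence. -/
lemma setLIntegral_gain_le_sum [NullSingletonClass μ] (hμ : IsClock μ) (hα : 0 < α) {a : ℝ≥0∞}
    {N : ℝ} (hN : 0 < N) {m : ℕ} {x z : ℕ → ℝ}
    (hD : IsDiscretization (fundamentalFunction (scale μ α) ν) (decay μ α ν) a N m x z) :
    ∫⁻ s in NNReal.toReal ⁻¹' Ico (x 0) N, gain μ ω α s ∂ν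
      ≤ 2 * (2 * 2 ^ α * a * ∑ k ∈ Finset.range (m + 1),
        fundamentalFunction (scale μ α) ν (x k) * gain μ ω α (x k)) := by
  have h2 : (1 : ℝ≥0∞) ≤ 2 ^ α := ENNReal.one_le_rpow (by simp) hα
  have hmeas : ∀ r y : ℝ, MeasurableSet (NNReal.toReal ⁻¹' Ico r y) := fun r y =>
    measurableSet_Ico.preimage (by fun_prop)
  -- On an interval of essentially constant fundamental function the mass of `ν` is bounded.
  have flat : ∀ {x z : ℝ}, 0 < z → fundamentalFunction (scale μ α) ν z
      ≤ a * fundamentalFunction (scale μ α) ν x →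
      ∫⁻ s in NNReal.toReal ⁻¹' Ico x z, gain μ ω α s ∂ν
        ≤ 2 * 2 ^ α * a * (fundamentalFunction (scale μ α) ν x * gain μ ω α x) := by
    intro x z hz hxz
    calc ∫⁻ s in NNReal.toReal ⁻¹' Ico x z, gain μ ω α s ∂ν
        ≤ ∫⁻ s in NNReal.toReal ⁻¹' Ico x z,
            gain μ ω α x * (2 * scale μ α z) * (scale μ α s + scale μ α z)⁻¹ ∂ν := by
          refine setLIntegral_mono' (hmeas _ _) fun s hs => ?_
          rw [mul_assoc, mul_assoc]
          exact (gain_antitone hs.1).trans (le_mul_of_one_le_right zero_le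
            (one_le_two_mul_mul_inv_add (scale_mono hα (le_of_lt hs.2)) (scale_pos hμ hz).ne'
              (scale_ne_top hμ hα z)))
      _ ≤ ∫⁻ s : ℝ≥0, gain μ ω α x * (2 * scale μ α z) * (scale μ α s + scale μ α z)⁻¹ ∂ν :=
          setLIntegral_le_lintegral _ _
      _ = 2 * 1 * fundamentalFunction (scale μ α) ν z * gain μ ω α x := by
          rw [lintegral_const_mul _ (measurable_inv_scale_add hα z), fundamentalFunction_eq, decay]
          ring
      _ ≤ 2 * 2 ^ α * (a * fundamentalFunction (scale μ α) ν x) * gain μ ω α x := by gcongr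
      _ = _ := by ring
  -- Where the fundamental function is essentially a multiple of the scale, the damping factor is
  -- comparable to the inverse of the scale, which dominates the gain by `rpow_mul_gain_le`.
  have steep : ∀ {y z : ℝ}, 0 < z → decay μ α ν z ≤ a * decay μ α ν y →
      ∫⁻ s in NNReal.toReal ⁻¹' Ico z y, gain μ ω α s ∂ν
        ≤ 2 * 2 ^ α * a * (fundamentalFunction (scale μ α) ν y * gain μ ω α y) := by
    intro y z hz hzy
    calc ∫⁻ s in NNReal.toReal ⁻¹' Ico z y, gain μ ω α s ∂ν
        ≤ ∫⁻ s in NNReal.toReal ⁻¹' Ico z y,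
            2 * 2 ^ α * (scale μ α y * gain μ ω α y) * (scale μ α s + scale μ α z)⁻¹ ∂ν := by
          refine setLIntegral_mono' (hmeas _ _) fun s hs => ?_
          have hs0 : (0 : ℝ) < s := hz.trans_le hs.1
          have hp := scale_pos (α := α) hμ hs0
          have hq := scale_ne_top hμ hα (s : ℝ)
          calc gain μ ω α s = (scale μ α s * gain μ ω α s) * (scale μ α s)⁻¹ := by
                rw [mul_comm, ← mul_assoc, ENNReal.inv_mul_cancel hp.ne' hq, one_mul]
            _ ≤ (2 ^ α * (scale μ α y * gain μ ω α y)) *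
                  (2 * (scale μ α s + scale μ α z)⁻¹) := by
                gcongr ?_ * ?_
                · exact rpow_mul_gain_le hμ hα hs0 hs.2.le
                · exact inv_le_two_mul_inv_add (scale_mono hα hs.1)
            _ = _ := by ring
      _ ≤ ∫⁻ s : ℝ≥0, 2 * 2 ^ α * (scale μ α y * gain μ ω α y) *
            (scale μ α s + scale μ α z)⁻¹ ∂ν := setLIntegral_le_lintegral _ _
      _ = 2 * 2 ^ α * (scale μ α y * gain μ ω α y) * decay μ α ν z := by
          rw [lintegral_const_mul _ (measurable_inv_scale_add hα z), decay]
      _ ≤ 2 * 2 ^ α * (scale μ α y * gain μ ω α y) * (a * decay μ α ν y) := by gcongr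
      _ = _ := by rw [fundamentalFunction_eq]; ring
  rw [Finset.mul_sum]
  exact setLIntegral_Ico_le_sum NNReal.toReal (fun s => gain μ ω α s)
    (fun k => 2 * 2 ^ α * a * (fundamentalFunction (scale μ α) ν (x k) * gain μ ω α (x k)))
    (fun k hk => flat (hD.mid_pos hk) (hD.h_mid k hk).le)
    (fun k hk => steep (hD.mid_pos hk) (hD.u_mid k hk).le)
    (flat hN hD.last)

/-- The superposition of test functions `F k`, constant up to `x k`, with the weights
`fundamentalFunction (x k) ^ (1 / α)` obeys the growth condition up to the factor `4`. -/
theorem sum_mul_setLIntegral_le [NullSingletonClass μ] (hμ : IsClock μ) (hα : 0 < α)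
    (H : IsProfile (fundamentalFunction (scale μ α) ν) (decay μ α ν)) {a : ℝ≥0∞} (ha : 2 ^ α ≤ a)
    {N : ℝ} {m : ℕ} {x z : ℕ → ℝ}
    (hD : IsDiscretization (fundamentalFunction (scale μ α) ν) (decay μ α ν) a N m x z)
    {K : ℝ≥0∞} (hK : ∀ F : ℝ → ℝ≥0∞, Antitone F →
      (∀ r, 0 < r → (∫⁻ s in Iio r, F s ∂μ) ^ α ≤ fundamentalFunction (scale μ α) ν r) →
      ∫⁻ s, F s ^ α ∂ω ≤ K)
    (F : ℕ → ℝ → ℝ≥0∞) (hF : ∀ k ≤ m, F k ∈ TestFun μ (x k)) (J : ℕ → Set ℝ)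
    (hJ : ∀ k, MeasurableSet (J k))
    (hJd : (Finset.range (m + 1) : Set ℕ).PairwiseDisjoint J) :
    ∑ k ∈ Finset.range (m + 1),
      fundamentalFunction (scale μ α) ν (x k) * ∫⁻ s in J k, F k s ^ α ∂ω ≤ 4 ^ α * K := by
  set A := fundamentalFunction (scale μ α) ν with hA
  set u := decay μ α ν with hu
  have hα' : 0 ≤ 1 / α := by positivity
  have h2a : (2 : ℝ≥0∞) ≤ a ^ (1 / α) := by
    calc (2 : ℝ≥0∞) = (2 ^ α) ^ (1 / α) := by rw [one_div, ENNReal.rpow_rpow_inv hα.ne']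
      _ ≤ _ := by gcongr
  let G : ℝ → ℝ≥0∞ := fun s => ∑ k ∈ Finset.range (m + 1), A (x k) ^ (1 / α) * F k s
  have hGa : Antitone G := fun s t hst => Finset.sum_le_sum fun k hk =>
    mul_le_mul_right ((hF k (by simpa [Nat.lt_succ_iff] using hk)).1 hst) _
  have hGr : ∀ r, 0 < r → ∫⁻ s in Iio r, G s ∂μ ≤ 4 * A r ^ (1 / α) := by
    intro r hr
    have term : ∀ k ∈ Finset.range (m + 1), ∫⁻ s in Iio r, A (x k) ^ (1 / α) * F k s ∂μ
        ≤ (if x k ≤ r then A (x k) ^ (1 / α) else 0)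
          + μ (Iio r) * (if r ≤ x k then u (x k) ^ (1 / α) else 0) := by
      intro k hk
      have hk : k ≤ m := by simpa [Nat.lt_succ_iff] using hk
      have hxk := hD.pos hk
      rw [lintegral_const_mul _ (hF k hk).1.measurable]
      rcases le_total (x k) r with h | h
      · rw [if_pos h]
        refine le_trans ?_ le_self_add
        calc A (x k) ^ (1 / α) * ∫⁻ s in Iio r, F k s ∂μ ≤ A (x k) ^ (1 / α) * 1 := by
              gcongr
              exact (setLIntegral_le_lintegral _ _).trans (hF k hk).2.2
          _ = _ := mul_one _
      · rw [if_pos h]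
        refine le_trans ?_ le_add_self
        have hAu : A (x k) ^ (1 / α) = μ (Iio (x k)) * u (x k) ^ (1 / α) := by
          rw [hA, fundamentalFunction_eq, ENNReal.mul_rpow_of_nonneg _ _ hα', scale, one_div,
            ENNReal.rpow_rpow_inv hα.ne']
        calc A (x k) ^ (1 / α) * ∫⁻ s in Iio r, F k s ∂μ
            ≤ A (x k) ^ (1 / α) * ((μ (Iio (x k)))⁻¹ * μ (Iio r)) := by
              gcongr
              rw [← setLIntegral_const]
              refine lintegral_mono fun s => ?_
              refine le_trans ?_ (TestFun.le_inv hμ hxk (hF k hk))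
              rcases le_total s (x k) with h1 | h1
              · exact ((hF k hk).2.1 s h1).le
              · exact (hF k hk).1 h1
          _ = (μ (Iio (x k)) * (μ (Iio (x k)))⁻¹) * (μ (Iio r) * u (x k) ^ (1 / α)) := by
              rw [hAu]; ring
          _ = _ := by
              rw [ENNReal.mul_inv_cancel (hμ.pos _ hxk).ne' (hμ.lt_top _).ne, one_mul]
    have hmeas : ∀ k ∈ Finset.range (m + 1), Measurable fun s => A (x k) ^ (1 / α) * F k s :=
      fun k hk => (hF k (by simpa [Nat.lt_succ_iff] using hk)).1.measurable.const_mul _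
    have hAr : A r ^ (1 / α) = μ (Iio r) * u r ^ (1 / α) := by
      rw [hA, fundamentalFunction_eq, ENNReal.mul_rpow_of_nonneg _ _ hα', scale, one_div,
        ENNReal.rpow_rpow_inv hα.ne']
    calc ∫⁻ s in Iio r, G s ∂μ
        = ∑ k ∈ Finset.range (m + 1), ∫⁻ s in Iio r, A (x k) ^ (1 / α) * F k s ∂μ :=
          lintegral_finsetSum' _ fun k hk => (hmeas k hk).aemeasurable
      _ ≤ ∑ k ∈ Finset.range (m + 1), ((if x k ≤ r then A (x k) ^ (1 / α) else 0)
          + μ (Iio r) * (if r ≤ x k then u (x k) ^ (1 / α) else 0)) := Finset.sum_le_sum term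
      _ = ∑ k ∈ Finset.range (m + 1), (if x k ≤ r then A (x k) ^ (1 / α) else 0)
          + μ (Iio r) * ∑ k ∈ Finset.range (m + 1),
            (if r ≤ x k then u (x k) ^ (1 / α) else 0) := by
          rw [Finset.sum_add_distrib, Finset.mul_sum]
      _ ≤ 2 * A r ^ (1 / α) + μ (Iio r) * (2 * u r ^ (1 / α)) := by
          gcongr
          · refine sum_ite_le_of_doubling (η := fun k => A (x k) ^ (1 / α)) (fun k => x k ≤ r)
              (fun k hk => ?_) fun k hk h => ?_
            · calc 2 * A (x k) ^ (1 / α) ≤ a ^ (1 / α) * A (x k) ^ (1 / α) := by gcongr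
                _ = (a * A (x k)) ^ (1 / α) := (ENNReal.mul_rpow_of_nonneg _ _ hα').symm
                _ ≤ _ := by gcongr; exact hD.h_succ H hk
            · gcongr
              exact H.mono (hD.pos hk) hr h
          · refine sum_ite_le_of_halving (η := fun k => u (x k) ^ (1 / α)) (fun k => r ≤ x k)
              (fun k hk => ?_) fun k hk h => ?_
            · calc 2 * u (x (k + 1)) ^ (1 / α) ≤ a ^ (1 / α) * u (x (k + 1)) ^ (1 / α) := by gcongr
                _ = (a * u (x (k + 1))) ^ (1 / α) := (ENNReal.mul_rpow_of_nonneg _ _ hα').symm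
                _ ≤ _ := by gcongr; exact hD.u_succ H hk
            · gcongr
              exact H.anti hr (hD.pos hk) h
      _ = _ := by rw [hAr]; ring
  have hGm : Measurable G := hGa.measurable
  have four : (4 : ℝ≥0∞) * 4⁻¹ = 1 := ENNReal.mul_inv_cancel (by simp) (by simp)
  have hK' := hK (fun s => 4⁻¹ * G s) (fun s t hst => mul_le_mul_right (hGa hst) _) fun r hr => by
    rw [lintegral_const_mul _ hGm]
    calc (4⁻¹ * ∫⁻ s in Iio r, G s ∂μ) ^ α ≤ (4⁻¹ * (4 * A r ^ (1 / α))) ^ α := by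
          gcongr; exact hGr r hr
      _ = A r := by
          rw [← mul_assoc, mul_comm _ 4, four, one_mul, one_div, ENNReal.rpow_inv_rpow hα.ne']
  calc ∑ k ∈ Finset.range (m + 1), A (x k) * ∫⁻ s in J k, F k s ^ α ∂ω
      ≤ ∑ k ∈ Finset.range (m + 1), ∫⁻ s in J k, G s ^ α ∂ω := by
        refine Finset.sum_le_sum fun k hk => ?_
        have hk' : k ≤ m := by simpa [Nat.lt_succ_iff] using hk
        rw [← lintegral_const_mul _ ((hF k hk').1.measurable.pow_const _)]
        refine lintegral_mono fun s => ?_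
        calc A (x k) * F k s ^ α = (A (x k) ^ (1 / α) * F k s) ^ α := by
              rw [ENNReal.mul_rpow_of_nonneg _ _ hα.le, one_div, ENNReal.rpow_inv_rpow hα.ne']
          _ ≤ _ := by
              gcongr
              exact Finset.single_le_sum (f := fun k => A (x k) ^ (1 / α) * F k s)
                (fun _ _ => zero_le) hk
    _ = ∫⁻ s in ⋃ k ∈ Finset.range (m + 1), J k, G s ^ α ∂ω :=
        (lintegral_biUnion_finset hJd (fun k _ => hJ k) _).symm
    _ ≤ ∫⁻ s, G s ^ α ∂ω := setLIntegral_le_lintegral _ _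
    _ = 4 ^ α * ∫⁻ s, (4⁻¹ * G s) ^ α ∂ω := by
        rw [← lintegral_const_mul' _ _ (ENNReal.rpow_ne_top_of_nonneg hα.le (by simp))]
        congr 1 with s
        rw [← ENNReal.mul_rpow_of_nonneg _ _ hα.le, ← mul_assoc, four, one_mul]
    _ ≤ _ := by gcongr

end

section

variable {μ ω : Measure ℝ} {α : ℝ} {ν : Measure ℝ≥0}

/-- The part of the gain at `t` which test functions collect on the set `J`. -/
noncomputable def gainOn (μ ω : Measure ℝ) (α : ℝ) (J : Set ℝ) (t : ℝ) : ℝ≥0∞ :=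
  ⨆ (F : ℝ → ℝ≥0∞) (_ : F ∈ TestFun μ t), ∫⁻ s in J, F s ^ α ∂ω

lemma sum_mul_gainOn_le {A : ℕ → ℝ≥0∞} {x : ℕ → ℝ} {m : ℕ} (J : ℕ → Set ℝ) {K : ℝ≥0∞}
    (h : ∀ F : ℕ → ℝ → ℝ≥0∞, (∀ k, F k ∈ TestFun μ (x k)) →
      ∑ k ∈ Finset.range (m + 1), A k * ∫⁻ s in J k, F k s ^ α ∂ω ≤ K) :
    ∑ k ∈ Finset.range (m + 1), A k * gainOn μ ω α (J k) (x k) ≤ K := by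
  classical
  simp_rw [gainOn, ENNReal.mul_iSup]
  refine sum_iSup_le_of_forall _ _ _ fun c => ?_
  let F : ℕ → ℝ → ℝ≥0∞ := fun k => if c k ∈ TestFun μ (x k) then c k else fun _ => 0
  refine le_trans (Finset.sum_le_sum fun k _ => iSup_le fun hk => ?_) (h F fun k => ?_)
  · simp only [F, if_pos hk, le_refl]
  · simp only [F]
    split_ifs with hk
    · exact hk
    · exact zero_mem_testFun _

lemma setLIntegral_Iic_le (hμ : IsClock μ) [NullSingletonClass ω] (hα : 0 < α) {t : ℝ} (ht : 0 < t)
    {F : ℝ → ℝ≥0∞} (hF : F ∈ TestFun μ t) :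
    ∫⁻ s in Iic t, F s ^ α ∂ω ≤ (scale μ α t)⁻¹ * ω (Iio t) := by
  rw [measure_congr (Iio_ae_eq_Iic (μ := ω) (a := t)), ← setLIntegral_const]
  refine setLIntegral_mono' measurableSet_Iic fun s hs => ?_
  rw [hF.2.1 s hs, scale, ← ENNReal.inv_rpow]
  gcongr
  exact TestFun.le_inv hμ ht hF

lemma gain_le_of_last (hμ : IsClock μ) [NullSingletonClass ω] (hα : 0 < α) {t : ℝ} (ht : 0 < t) :
    gain μ ω α t ≤ (scale μ α t)⁻¹ * ω (Iio t) + gainOn μ ω α (Ioi t) t := by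
  refine iSup₂_le fun F hF => ?_
  calc ∫⁻ s, F s ^ α ∂ω = ∫⁻ s in Iic t ∪ Ioi t, F s ^ α ∂ω := by
        rw [Iic_union_Ioi, Measure.restrict_univ]
    _ ≤ ∫⁻ s in Iic t, F s ^ α ∂ω + ∫⁻ s in Ioi t, F s ^ α ∂ω := lintegral_union_le _ _ _
    _ ≤ _ := by
        gcongr
        · exact setLIntegral_Iic_le hμ hα ht hF
        · exact le_iSup₂_of_le (f := fun F _ => ∫⁻ s in Ioi t, F s ^ α ∂ω) F hF le_rfl

/-- Localization of the gain at `t` to `(t, t']`: the rest of the line costs the mass of `ω` before `t`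
and the gain at `t'`. -/
lemma gain_le_of_next (hμ : IsClock μ) [NullSingletonClass ω] (hα : 0 < α) {t t' : ℝ} (ht : 0 < t)
    (h : t ≤ t') :
    gain μ ω α t ≤ (scale μ α t)⁻¹ * ω (Iio t) + gainOn μ ω α (Ioc t t') t + gain μ ω α t' := by
  refine iSup₂_le fun F hF => ?_
  have hG : (fun s => F (max s t')) ∈ TestFun μ t' :=
    ⟨fun a b hab => hF.1 (max_le_max_right _ hab), fun s hs => by simp only [max_eq_right hs, max_self],
      (lintegral_mono fun s => hF.1 (le_max_left _ _)).trans hF.2.2⟩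
  calc ∫⁻ s, F s ^ α ∂ω = ∫⁻ s in (Iic t ∪ Ioc t t') ∪ Ioi t', F s ^ α ∂ω := by
        rw [Iic_union_Ioc_eq_Iic h, Iic_union_Ioi, Measure.restrict_univ]
    _ ≤ ∫⁻ s in Iic t, F s ^ α ∂ω + ∫⁻ s in Ioc t t', F s ^ α ∂ω + ∫⁻ s in Ioi t', F s ^ α ∂ω :=
        (lintegral_union_le _ _ _).trans (by gcongr; exact lintegral_union_le _ _ _)
    _ ≤ _ := by
        gcongr ?_ + ?_ + ?_
        · exact setLIntegral_Iic_le hμ hα ht hF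
        · exact le_iSup₂_of_le (f := fun F _ => ∫⁻ s in Ioc t t', F s ^ α ∂ω) F hF le_rfl
        · calc ∫⁻ s in Ioi t', F s ^ α ∂ω = ∫⁻ s in Ioi t', F (max s t') ^ α ∂ω :=
                setLIntegral_congr_fun measurableSet_Ioi fun s (hs : t' < s) => by
                  simp only [max_eq_left hs.le]
            _ ≤ ∫⁻ s, F (max s t') ^ α ∂ω := setLIntegral_le_lintegral _ _
            _ ≤ _ := le_iSup₂_of_le (f := fun F _ => ∫⁻ s, F s ^ α ∂ω) _ hG le_rfl

/-- The geometric growth along a discretizing sequence localizes the gain at `x k` to the interval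
between `x k` and `x (k + 1)`, so that the test functions for different `k` do not interfere. -/
theorem sum_fundamentalFunction_mul_gain_le_of_bound [NullSingletonClass μ] [NullSingletonClass ω]
    (hμ : IsClock μ) (hα : 0 < α)
    (H : IsProfile (fundamentalFunction (scale μ α) ν) (decay μ α ν)) {a : ℝ≥0∞} (ha : 2 ^ α ≤ a)
    (ha8 : 8 ≤ a) {N : ℝ} {m : ℕ} {x z : ℕ → ℝ}
    (hD : IsDiscretization (fundamentalFunction (scale μ α) ν) (decay μ α ν) a N m x z)
    {K : ℝ≥0∞} (hK : ∀ F : ℝ → ℝ≥0∞, Antitone F →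
      (∀ r, 0 < r → (∫⁻ s in Iio r, F s ∂μ) ^ α ≤ fundamentalFunction (scale μ α) ν r) →
      ∫⁻ s, F s ^ α ∂ω ≤ K) :
    ∑ k ∈ Finset.range (m + 1), fundamentalFunction (scale μ α) ν (x k) * gain μ ω α (x k)
      ≤ 6 * (4 ^ α * K) := by
  set A := fundamentalFunction (scale μ α) ν with hA
  set u := decay μ α ν with hu
  have hAu : ∀ k ≤ m, A (x k) * (scale μ α (x k))⁻¹ = u (x k) := fun k hk => by
    rw [hA, fundamentalFunction_eq, mul_right_comm,
      ENNReal.mul_inv_cancel (scale_pos hμ (hD.pos hk)).ne' (scale_ne_top hμ hα _), one_mul]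
  have ha2 : (2 : ℝ≥0∞) ≤ a := le_trans (by norm_num) ha8
  have half : ∀ {b c : ℝ≥0∞}, a * b ≤ c → b ≤ c / 2 := fun {b c} h => by
    rw [ENNReal.le_div_iff_mul_le (by simp) (by simp), mul_comm]
    exact le_trans (by gcongr) h
  -- The contribution of the intervals to the right of the points.
  let J : ℕ → Set ℝ := fun k => if k < m then Ioc (x k) (x (k + 1)) else Ioi (x m)
  have hJ : ∀ k, MeasurableSet (J k) := fun k => by
    simp only [J]; split_ifs <;> measurability
  have hJd : (Finset.range (m + 1) : Set ℕ).PairwiseDisjoint J := by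
    have aux : ∀ i j, i < j → j ≤ m → Disjoint (J i) (J j) := fun i j hij hj => by
      refine disjoint_left.2 fun s hsi hsj => ?_
      simp only [J, if_pos (hij.trans_le hj)] at hsi
      have h1 : s ≤ x j := hsi.2.trans (hD.le_of_le hij hj)
      have h2 : x j < s := by
        simp only [J] at hsj
        split_ifs at hsj with h3
        · exact hsj.1
        · have : j = m := by omega
          exact this ▸ hsj
      exact absurd h2 (not_lt.2 h1)
    intro i hi j hj hij
    simp only [Finset.coe_range, mem_Iio] at hi hj
    rcases lt_or_gt_of_ne hij with h | h
    · exact aux i j h (by omega)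
    · exact (aux j i h (by omega)).symm
  have right : ∑ k ∈ Finset.range (m + 1), A (x k) * gainOn μ ω α (J k) (x k) ≤ 4 ^ α * K :=
    sum_mul_gainOn_le J fun F hF =>
      sum_mul_setLIntegral_le hμ hα H ha hD hK F (fun k _ => hF k) J hJ hJd
  -- The contribution of the intervals to the left of the points, where characteristic functions
  -- are used for testing.
  let I : ℕ → Set ℝ := fun k => if k = 0 then Iic (x 0) else Ioc (x (k - 1)) (x k)
  have hI : ∀ k, MeasurableSet (I k) := fun k => by
    simp only [I]; split_ifs <;> measurability
  have hIle : ∀ k, I k ⊆ Iic (x k) := fun k s hs => by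
    simp only [I] at hs
    split_ifs at hs with h0
    · exact h0 ▸ hs
    · exact hs.2
  have hId : (Finset.range (m + 1) : Set ℕ).PairwiseDisjoint I := by
    have aux : ∀ i j, i < j → j ≤ m → Disjoint (I i) (I j) := fun i j hij hj => by
      refine disjoint_left.2 fun s hsi hsj => ?_
      have h1 : s ≤ x i := hIle i hsi
      have h2 : x (j - 1) < s := by
        simp only [I, if_neg (show j ≠ 0 by omega)] at hsj
        exact hsj.1
      exact absurd (h2.trans_le h1) (not_lt.2 (hD.le_of_le (by omega) (by omega)))
    intro i hi j hj hij
    simp only [Finset.coe_range, mem_Iio] at hi hj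
    rcases lt_or_gt_of_ne hij with h | h
    · exact aux i j h (by omega)
    · exact (aux j i h (by omega)).symm
  have left : ∑ k ∈ Finset.range (m + 1), u (x k) * ω (I k) ≤ 4 ^ α * K := by
    refine le_trans (le_of_eq (Finset.sum_congr rfl fun k hk => ?_))
      (sum_mul_setLIntegral_le hμ hα H ha hD hK
        (fun k => (Iic (x k)).indicator fun _ => (μ (Iio (x k)))⁻¹)
        (fun k hk => indicator_mem_testFun hμ (hD.pos hk) le_rfl) I hI hId)
    have hk : k ≤ m := by simpa [Nat.lt_succ_iff] using hk
    rw [setLIntegral_congr_fun (g := fun _ => (scale μ α (x k))⁻¹) (hI k) fun s hs => ?_,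
      setLIntegral_const, ← mul_assoc, hAu k hk]
    simp only [indicator_of_mem (hIle k hs), scale, ENNReal.inv_rpow]
  have sumW : ∑ k ∈ Finset.range (m + 1), u (x k) * ω (Iio (x k))
      ≤ 2 * ∑ k ∈ Finset.range (m + 1), u (x k) * ω (I k) := by
    refine sum_le_two_mul_of_succ_le (b := fun k => u (x k) * ω (Iio (x k)))
      (r := fun k => u (x k) * ω (I k)) ?_ fun k hk => ?_
    · gcongr
      simp only [I, if_true]
      exact Iio_subset_Iic_self
    · have hsub : Iio (x (k + 1)) ⊆ I (k + 1) ∪ Iic (x k) := fun s hs => by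
        simp only [I, if_neg (Nat.succ_ne_zero k), Nat.add_sub_cancel]
        rcases le_or_gt s (x k) with h | h
        · exact Or.inr h
        · exact Or.inl ⟨h, le_of_lt hs⟩
      have hm : ω (Iio (x (k + 1))) ≤ ω (I (k + 1)) + ω (Iio (x k)) := by
        rw [measure_congr (Iio_ae_eq_Iic (μ := ω) (a := x k))]
        exact (measure_mono hsub).trans (measure_union_le _ _)
      calc u (x (k + 1)) * ω (Iio (x (k + 1)))
          ≤ u (x (k + 1)) * (ω (I (k + 1)) + ω (Iio (x k))) := by gcongr
        _ = u (x (k + 1)) * ω (I (k + 1)) + u (x (k + 1)) * ω (Iio (x k)) := mul_add _ _ _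
        _ ≤ u (x (k + 1)) * ω (I (k + 1)) + u (x k) / 2 * ω (Iio (x k)) := by
            gcongr
            exact half (hD.u_succ H hk)
        _ = _ := by rw [← ENNReal.mul_div_right_comm]
  have sumG : ∑ k ∈ Finset.range (m + 1), A (x k) * gain μ ω α (x k)
      ≤ 2 * ∑ k ∈ Finset.range (m + 1),
        (u (x k) * ω (Iio (x k)) + A (x k) * gainOn μ ω α (J k) (x k)) := by
    refine sum_le_two_mul_of_le_succ (b := fun k => A (x k) * gain μ ω α (x k))
      (r := fun k => u (x k) * ω (Iio (x k)) + A (x k) * gainOn μ ω α (J k) (x k)) ?_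
      fun k hk => ?_
    · rw [← hAu m le_rfl, mul_assoc, ← mul_add]
      gcongr
      simp only [J, if_neg (lt_irrefl m)]
      exact gain_le_of_last hμ hα (hD.pos le_rfl)
    · rw [← hAu k hk.le]
      calc A (x k) * gain μ ω α (x k)
          ≤ A (x k) * ((scale μ α (x k))⁻¹ * ω (Iio (x k)) + gainOn μ ω α (J k) (x k)
            + gain μ ω α (x (k + 1))) := by
            gcongr
            simp only [J, if_pos hk]
            exact gain_le_of_next hμ hα (hD.pos hk.le) (hD.le_succ hk)
        _ = A (x k) * (scale μ α (x k))⁻¹ * ω (Iio (x k)) + A (x k) * gainOn μ ω α (J k) (x k)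
            + A (x k) * gain μ ω α (x (k + 1)) := by ring
        _ ≤ A (x k) * (scale μ α (x k))⁻¹ * ω (Iio (x k)) + A (x k) * gainOn μ ω α (J k) (x k)
            + A (x (k + 1)) / 2 * gain μ ω α (x (k + 1)) := by
            gcongr
            exact half (hD.h_succ H hk)
        _ = _ := by rw [← ENNReal.mul_div_right_comm]
  calc ∑ k ∈ Finset.range (m + 1), A (x k) * gain μ ω α (x k)
      ≤ 2 * (2 * (4 ^ α * K) + 4 ^ α * K) := by
        refine sumG.trans ?_
        rw [Finset.sum_add_distrib]
        gcongr
        exact sumW.trans (by gcongr)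
    _ = _ := by ring

/-- A bound for `∫ F ^ α` valid for all non-increasing `F` obeying the growth condition controls
the integral of the gain against the representation measure. -/
theorem exists_lintegral_gain_le [NullSingletonClass μ] [NullSingletonClass ω] (hμ : IsClock μ)
    (hα : 0 < α)
    (hν : ∀ t, 0 < t → 0 < fundamentalFunction (scale μ α) ν t ∧
      fundamentalFunction (scale μ α) ν t < ∞) :
    ∃ C : ℝ≥0∞, C ≠ ∞ ∧ ∀ K : ℝ≥0∞, (∀ F : ℝ → ℝ≥0∞, Antitone F →
      (∀ r, 0 < r → (∫⁻ s in Iio r, F s ∂μ) ^ α ≤ fundamentalFunction (scale μ α) ν r) →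
      ∫⁻ s, F s ^ α ∂ω ≤ K) → ∫⁻ s : ℝ≥0, gain μ ω α s ∂ν ≤ C * K := by
  obtain ⟨a, ha8, ha, hat⟩ := exists_ratio α
  have H := isProfile_fundamentalFunction hμ hα hν
  have ha1 : 1 < a := lt_of_lt_of_le (by norm_num) ha8
  have h2 : (2 : ℝ≥0∞) ^ α ≠ ∞ := ENNReal.rpow_ne_top_of_ne_zero (by simp) (by simp)
  have h4 : (4 : ℝ≥0∞) ^ α ≠ ∞ := ENNReal.rpow_ne_top_of_ne_zero (by simp) (by simp)
  refine ⟨1 + 2 * (2 * 2 ^ α * a * (6 * 4 ^ α)), by finiteness, fun K hK => ?_⟩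
  have main : ∀ ε N : ℝ, 0 < ε → 0 < N → ∫⁻ s in NNReal.toReal ⁻¹' Ico ε N, gain μ ω α s ∂ν
      ≤ 2 * (2 * 2 ^ α * a * (6 * 4 ^ α)) * K := by
    intro ε N hε hN
    obtain ⟨m, x, z, rfl, hD⟩ := H.exists_isDiscretization ha1 hat hε hN
    refine (setLIntegral_gain_le_sum hμ hα hN hD).trans ?_
    calc _ ≤ 2 * (2 * 2 ^ α * a * (6 * (4 ^ α * K))) := by
          gcongr
          exact sum_fundamentalFunction_mul_gain_le_of_bound hμ hα H ha ha8 hD hK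
      _ = _ := by ring
  have hpos := setLIntegral_Ioi_le_of_forall_Ico NNReal.toReal (fun s => gain μ ω α s) _ main
  -- An atom at the origin is tested with multiples of a single test function.
  have hzero : ∫⁻ s in ({0} : Set ℝ≥0), gain μ ω α s ∂ν ≤ K := by
    rw [lintegral_singleton]
    simp only [NNReal.coe_zero]
    rw [mul_comm, gain, ENNReal.mul_iSup]
    refine iSup_le fun F => ?_
    rw [ENNReal.mul_iSup]
    refine iSup_le fun hF => ?_
    have hnu : ∀ r, 0 < r → ν {0} ≤ fundamentalFunction (scale μ α) ν r := fun r hr => by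
      have h0 : scale μ α ((0 : ℝ≥0) : ℝ) = 0 := by
        rw [scale, NNReal.coe_zero, measure_mono_null Iio_subset_Iic_self hμ.null,
          ENNReal.zero_rpow_of_pos hα]
      calc ν {0} = scale μ α r * ((scale μ α ((0 : ℝ≥0) : ℝ) + scale μ α r)⁻¹ * ν {0}) := by
            rw [h0, zero_add, ← mul_assoc,
              ENNReal.mul_inv_cancel (scale_pos hμ hr).ne' (scale_ne_top hμ hα r), one_mul]
        _ ≤ _ := by
            rw [fundamentalFunction_eq, decay]
            gcongr
            rw [← lintegral_singleton (fun s : ℝ≥0 => (scale μ α s + scale μ α r)⁻¹)]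
            exact setLIntegral_le_lintegral _ _
    have htop : ν {0} ^ (1 / α) ≠ ∞ := ENNReal.rpow_ne_top_of_nonneg (by positivity)
      ((hnu 1 one_pos).trans_lt (hν 1 one_pos).2).ne
    have := hK (fun s => ν {0} ^ (1 / α) * F s)
      (fun s t hst => mul_le_mul_right (hF.1 hst) _) fun r hr => by
        rw [lintegral_const_mul _ hF.1.measurable]
        calc (ν {0} ^ (1 / α) * ∫⁻ s in Iio r, F s ∂μ) ^ α ≤ (ν {0} ^ (1 / α) * 1) ^ α := by
              gcongr
              exact (setLIntegral_le_lintegral _ _).trans hF.2.2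
          _ = ν {0} := by rw [mul_one, one_div, ENNReal.rpow_inv_rpow hα.ne']
          _ ≤ _ := hnu r hr
    refine le_trans (le_of_eq ?_) this
    simp_rw [ENNReal.mul_rpow_of_nonneg _ _ hα.le, one_div, ENNReal.rpow_inv_rpow hα.ne']
    exact (lintegral_const_mul _ (hF.1.measurable.pow_const _)).symm
  have hU : ({0} : Set ℝ≥0) ∪ NNReal.toReal ⁻¹' Ioi 0 = univ := by
    ext s
    simpa using (eq_or_ne s 0).imp_right pos_iff_ne_zero.2
  calc ∫⁻ s : ℝ≥0, gain μ ω α s ∂ν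
      = ∫⁻ s in ({0} : Set ℝ≥0) ∪ NNReal.toReal ⁻¹' Ioi 0, gain μ ω α s ∂ν := by
        rw [hU, Measure.restrict_univ]
    _ ≤ K + 2 * (2 * 2 ^ α * a * (6 * 4 ^ α)) * K :=
        (lintegral_union_le _ _ _).trans (add_le_add hzero hpos)
    _ = _ := by ring

end

section

variable {μ ω : Measure ℝ} {α : ℝ}

/-! ### The gain for exponents at least one -/

lemma iSup_div_le_gain [NullSingletonClass μ] [NullSingletonClass ω] (hμ : IsClock μ)
    (hα : 0 < α) {t : ℝ} (ht : 0 ≤ t) :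
    ⨆ s ∈ Ioi t, ω (Iio s) / scale μ α s ≤ gain μ ω α t :=
  iSup₂_le fun _ hs => ENNReal.div_le_of_le_mul' <|
    measure_le_gain hμ hα (ht.trans_lt hs) (le_of_lt hs)

/-- Lower sets of finite clock measure which contain `t`, if they meet `(0, ∞)`, are intervals,
and their `ω`-measure is estimated by the supremum. -/
lemma measure_lowerSet_le [NullSingletonClass ω] (hμ : IsClock μ) (hω : ω (Iic 0) = 0)
    (hα : 0 < α) {t : ℝ} {T : Set ℝ} (hT : IsLowerSet T) (htT : ∀ s ∈ T, s ≤ t → t ∈ T)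
    (hfin : μ T < ∞) {B : ℝ≥0∞} (hB : B ≠ ∞) (h : ∀ s > t, ω (Iio s) ≤ B * scale μ α s) :
    ω T ≤ B * μ T ^ α := by
  by_cases h0 : T ⊆ Iic 0
  · rw [measure_mono_null h0 hω]; exact zero_le
  obtain ⟨s, hsT, hs⟩ := not_subset.1 h0
  have hs : 0 < s := not_le.1 hs
  have hbdd : BddAbove T := by
    by_contra hcon
    have huniv : T = univ := by
      refine eq_univ_of_forall fun r => ?_
      obtain ⟨y, hy, hry⟩ := not_bddAbove_iff.1 hcon r
      exact hT hry.le hy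
    obtain ⟨r, hr⟩ := (hμ.tendsto_atTop.eventually (eventually_gt_nhds hfin)).exists
    exact absurd (measure_mono (huniv ▸ subset_univ (Iio r))) (not_le.2 hr)
  have hle : T ⊆ Iic (sSup T) := fun y hy => le_csSup hbdd hy
  have hge : Iio (sSup T) ⊆ T := fun y (hy : y < sSup T) => by
    obtain ⟨r, hr, hyr⟩ := exists_lt_of_lt_csSup ⟨s, hsT⟩ hy
    exact hT hyr.le hr
  have htS : t ≤ sSup T := by
    rcases le_total s t with h1 | h1
    · exact hle (htT s hsT h1)
    · exact h1.trans (hle hsT)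
  have hlim : Tendsto (fun s => B * scale μ α s) (𝓝[>] sSup T) (𝓝 (B * scale μ α (sSup T))) :=
    ENNReal.Tendsto.const_mul ((continuous_scale hμ).continuousAt.mono_left nhdsWithin_le_nhds)
      (Or.inr hB)
  calc ω T ≤ ω (Iio (sSup T)) := by
        rw [measure_congr (Iio_ae_eq_Iic (μ := ω))]; exact measure_mono hle
    _ ≤ B * scale μ α (sSup T) := by
        refine ge_of_tendsto hlim ?_
        filter_upwards [self_mem_nhdsWithin] with r hr
        exact (measure_mono (Iio_subset_Iio (le_of_lt hr))).trans (h r (htS.trans_lt hr))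
    _ ≤ _ := by
        rw [scale]; gcongr

lemma ne_top_of_testFun (hμ : IsClock μ) {t s : ℝ} {F : ℝ → ℝ≥0∞} (hF : F ∈ TestFun μ t)
    (hs : 0 < s) : F s ≠ ∞ := by
  intro hcon
  have h1 := (mul_measure_le_lintegral (μ := μ) hF.1 s).trans
    ((setLIntegral_le_lintegral _ _).trans hF.2.2)
  rw [hcon, ENNReal.top_mul (hμ.pos s hs).ne'] at h1
  simp at h1

lemma ae_pos_of_null (hω : ω (Iic 0) = 0) : ∀ᵐ s ∂ω, 0 < s := by
  rw [ae_iff]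
  simpa [Iic] using hω

/-- For exponents `α ≥ 1` the gain is comparable to the supremum of the quotients of the
distribution functions: a function is the superposition of the characteristic functions of its
level sets. -/
theorem gain_le_mul_iSup_div [NullSingletonClass ω] (hμ : IsClock μ)
    (hω : ω (Iic 0) = 0) (hα : 1 ≤ α) {t : ℝ} (ht : 0 ≤ t) :
    gain μ ω α t ≤ ENNReal.ofReal α * ⨆ s ∈ Ioi t, ω (Iio s) / scale μ α s := by
  have hα0 : 0 < α := zero_lt_one.trans_le hα
  set B := ⨆ s ∈ Ioi t, ω (Iio s) / scale μ α s
  rcases eq_or_ne B ∞ with hB | hB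
  · rw [hB, ENNReal.mul_top (by simpa using hα0)]; exact le_top
  have hBs : ∀ s > t, ω (Iio s) ≤ B * scale μ α s := fun s hs =>
    (ENNReal.div_le_iff (scale_pos hμ (ht.trans_lt hs)).ne' (scale_ne_top hμ hα0 s)).1
      (le_iSup₂_of_le (f := fun s (_ : s ∈ Ioi t) => ω (Iio s) / scale μ α s) s hs le_rfl)
  refine iSup₂_le fun F hF => ?_
  have hofω : ∀ᵐ s ∂ω, F s = ENNReal.ofReal (F s).toReal := by
    filter_upwards [ae_pos_of_null hω] with s hs
    exact (ENNReal.ofReal_toReal (ne_top_of_testFun hμ hF hs)).symm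
  have hofμ : ∀ᵐ s ∂μ, F s = ENNReal.ofReal (F s).toReal := by
    filter_upwards [ae_pos_of_null hμ.null] with s hs
    exact (ENNReal.ofReal_toReal (ne_top_of_testFun hμ hF hs)).symm
  have hmeas : Measurable fun s => (F s).toReal := hF.1.measurable.ennreal_toReal
  have level : ∀ l : ℝ, 0 < l → ω {s | l < (F s).toReal} * ENNReal.ofReal (l ^ (α - 1))
      ≤ B * μ {s | l < (F s).toReal} := by
    intro l hl
    set T := {s | ENNReal.ofReal l < F s} with hT
    have hmarkov : ENNReal.ofReal l * μ T ≤ 1 := by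
      refine le_trans ?_ hF.2.2
      refine le_trans ?_ (mul_meas_ge_le_lintegral hF.1.measurable (ENNReal.ofReal l))
      refine mul_le_mul_right (measure_mono fun s (hs : ENNReal.ofReal l < F s) => ?_) _
      exact show ENNReal.ofReal l ≤ F s from hs.le
    have hfin : μ T < ∞ := by
      by_contra hcon
      rw [not_lt, top_le_iff] at hcon
      rw [hcon, ENNReal.mul_top (by simpa using hl)] at hmarkov
      simp at hmarkov
    have h1 : ω T ≤ B * μ T ^ α := by
      refine measure_lowerSet_le (t := t) hμ hω hα0
        (fun a b hab (ha : ENNReal.ofReal l < F a) => show ENNReal.ofReal l < F b from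
          ha.trans_le (hF.1 hab)) (fun s (hs : ENNReal.ofReal l < F s) hst => ?_) hfin hB hBs
      exact show ENNReal.ofReal l < F t from hF.2.1 s hst ▸ hs
    have h2 : ω {s | l < (F s).toReal} ≤ ω T := by
      refine measure_mono fun s (hs : l < (F s).toReal) => ?_
      have hne : F s ≠ ∞ := fun h => by
        rw [h, ENNReal.toReal_top] at hs; exact absurd hs (not_lt.2 hl.le)
      exact (ENNReal.ofReal_lt_iff_lt_toReal hl.le hne).2 hs
    have h3 : μ T ≤ μ {s | l < (F s).toReal} := by
      refine measure_mono_ae ?_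
      filter_upwards [ae_pos_of_null hμ.null] with s hs (h : ENNReal.ofReal l < F s)
      exact (ENNReal.ofReal_lt_iff_lt_toReal hl.le (ne_top_of_testFun hμ hF hs)).1 h
    have hα1 : 0 ≤ α - 1 := by linarith
    calc ω {s | l < (F s).toReal} * ENNReal.ofReal (l ^ (α - 1))
        ≤ B * μ T ^ α * ENNReal.ofReal (l ^ (α - 1)) := by gcongr; exact h2.trans h1
      _ = B * μ T * (ENNReal.ofReal l * μ T) ^ (α - 1) := by
          have : μ T ^ α = μ T * μ T ^ (α - 1) := by
            conv_rhs => rw [← ENNReal.rpow_one (μ T), ← ENNReal.rpow_mul, one_mul]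
            rw [← ENNReal.rpow_add_of_nonneg _ _ zero_le_one hα1]
            congr 1; ring
          rw [this, ENNReal.mul_rpow_of_nonneg _ _ hα1, ENNReal.ofReal_rpow_of_pos hl]
          ring
      _ ≤ B * μ T * 1 := by
          gcongr
          exact ENNReal.rpow_le_one hmarkov hα1
      _ ≤ _ := by rw [mul_one]; gcongr
  calc ∫⁻ s, F s ^ α ∂ω = ∫⁻ s, ENNReal.ofReal ((F s).toReal ^ α) ∂ω := by
        refine lintegral_congr_ae ?_
        filter_upwards [hofω] with s hs
        conv_lhs => rw [hs]
        rw [ENNReal.ofReal_rpow_of_nonneg ENNReal.toReal_nonneg hα0.le]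
    _ = ENNReal.ofReal α * ∫⁻ l in Ioi (0 : ℝ), ω {s | l < (F s).toReal}
          * ENNReal.ofReal (l ^ (α - 1)) :=
        lintegral_rpow_eq_lintegral_meas_lt_mul ω
          (Eventually.of_forall fun _ => ENNReal.toReal_nonneg) hmeas.aemeasurable hα0
    _ ≤ ENNReal.ofReal α * ∫⁻ l in Ioi (0 : ℝ), B * μ {s | l < (F s).toReal} := by
        gcongr ENNReal.ofReal α * ?_
        exact setLIntegral_mono' measurableSet_Ioi level
    _ = ENNReal.ofReal α * (B * ∫⁻ s, F s ∂μ) := by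
        rw [lintegral_const_mul' _ _ hB, lintegral_congr_ae hofμ,
          lintegral_eq_lintegral_meas_lt μ
          (Eventually.of_forall fun _ => ENNReal.toReal_nonneg) hmeas.aemeasurable]
    _ ≤ ENNReal.ofReal α * (B * 1) := by gcongr; exact hF.2.2
    _ = _ := by rw [mul_one]

/-! ### Powers of the distribution function of a clock -/

/-- The distribution function of a clock transports it to Lebesgue measure on `(0, ∞)`. -/
theorem IsClock.map_eq [NullSingletonClass μ] (hμ : IsClock μ) :
    Measure.map (fun t => (μ (Iio t)).toReal) μ = volume.restrict (Ioi (0 : ℝ)) := by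
  set Φ : ℝ → ℝ := fun t => (μ (Iio t)).toReal with hΦ
  have hof : ∀ t, ENNReal.ofReal (Φ t) = μ (Iio t) := fun t =>
    ENNReal.ofReal_toReal (hμ.lt_top t).ne
  have hmono : Monotone Φ := fun s t h =>
    ENNReal.toReal_mono (hμ.lt_top t).ne (measure_mono (Iio_subset_Iio h))
  have hstrict : StrictMonoOn Φ (Ici 0) := fun s hs t ht h =>
    (ENNReal.toReal_lt_toReal (hμ.lt_top s).ne (hμ.lt_top t).ne).2 (hμ.strictMono hs ht h)
  have hcont : Continuous Φ := continuous_iff_continuousAt.2 fun t =>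
    (ENNReal.tendsto_toReal (hμ.lt_top t).ne).comp (hμ.continuous.tendsto t)
  have hΦ0 : Φ 0 = 0 := by simp [hΦ, hμ.measure_Iio_zero]
  have hneg : ∀ s ≤ 0, Φ s = 0 := fun s hs => le_antisymm (hΦ0 ▸ hmono hs) ENNReal.toReal_nonneg
  have hsurj : ∀ y : ℝ, 0 ≤ y → ∃ s, 0 ≤ s ∧ Φ s = y := fun y hy => by
    obtain ⟨N, hN, hN0⟩ := ((hμ.tendsto_atTop.eventually
      (eventually_gt_nhds (ENNReal.ofReal_lt_top (r := y)))).and (eventually_ge_atTop 0)).exists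
    have hyN : y ≤ Φ N := ((ENNReal.ofReal_lt_iff_lt_toReal hy (hμ.lt_top N).ne).1 hN).le
    obtain ⟨s, hs, hsy⟩ := intermediate_value_Icc hN0 hcont.continuousOn ⟨hΦ0.trans_le hy, hyN⟩
    exact ⟨s, hs.1, hsy⟩
  have main : ∀ a b : ℝ, 0 ≤ a → μ (Φ ⁻¹' Ioo a b) = ENNReal.ofReal (b - a) := by
    intro a b ha
    rcases le_or_gt b a with hab | hab
    · rw [Ioo_eq_empty (not_lt.2 hab), preimage_empty, measure_empty,
        ENNReal.ofReal_of_nonpos (by linarith)]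
    obtain ⟨sa, hsa, rfl⟩ := hsurj a ha
    obtain ⟨sb, hsb, rfl⟩ := hsurj b (ha.trans hab.le)
    have hpre : Φ ⁻¹' Ioo (Φ sa) (Φ sb) = Iio sb \ Iic sa := by
      ext s
      simp only [mem_preimage, mem_Ioo, Set.mem_sdiff, mem_Iio, mem_Iic, not_le]
      rcases le_total 0 s with hs | hs
      · rw [hstrict.lt_iff_lt hsa hs, hstrict.lt_iff_lt hs hsb, and_comm]
      · rw [hneg s hs]
        constructor
        · rintro ⟨h1, -⟩; exact absurd h1 (not_lt.2 ha)
        · rintro ⟨-, h1⟩; exact absurd h1 (not_lt.2 (hs.trans hsa))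
    have hlt : sa < sb := (hstrict.lt_iff_lt hsa hsb).1 hab
    rw [hpre, measure_sdiff (Iic_subset_Iio.2 hlt)
      measurableSet_Iic.nullMeasurableSet (by
        rw [← measure_congr (Iio_ae_eq_Iic (μ := μ))]; exact (hμ.lt_top sa).ne),
      ← measure_congr (Iio_ae_eq_Iic (μ := μ) (a := sa)), ← hof, ← hof,
      ENNReal.ofReal_sub _ ENNReal.toReal_nonneg]
  symm
  refine Real.measure_ext_Ioo_rat fun a b => ?_
  rw [Measure.map_apply hmono.measurable measurableSet_Ioo, Measure.restrict_apply
    measurableSet_Ioo, Ioo_inter_Ioi, Real.volume_Ioo, ← main _ _ (le_max_right _ _)]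
  refine measure_congr ?_
  filter_upwards [ae_pos_of_null hμ.null] with s hs
  have hpos : 0 < Φ s := hΦ0 ▸ hstrict self_mem_Ici hs.le hs
  refine propext ⟨fun h => ⟨lt_of_le_of_lt (le_max_left _ _) h.1, h.2⟩, fun h => ?_⟩
  exact ⟨max_lt h.1 hpos, h.2⟩

lemma IsClock.lintegral_comp [NullSingletonClass μ] (hμ : IsClock μ) {k : ℝ → ℝ≥0∞}
    (hk : Measurable k) :
    ∫⁻ s, k (μ (Iio s)).toReal ∂μ = ∫⁻ y in Ioi (0 : ℝ), k y := by
  have hmono : Monotone fun t => (μ (Iio t)).toReal := fun s t h =>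
    ENNReal.toReal_mono (hμ.lt_top t).ne (measure_mono (Iio_subset_Iio h))
  rw [← hμ.map_eq, lintegral_map hk hmono.measurable]

lemma IsClock.toReal_lt_iff (hμ : IsClock μ) {s t : ℝ} (hs : 0 ≤ s) (ht : 0 ≤ t) :
    (μ (Iio s)).toReal < (μ (Iio t)).toReal ↔ s < t := by
  rw [ENNReal.toReal_lt_toReal (hμ.lt_top s).ne (hμ.lt_top t).ne]
  exact hμ.strictMono.lt_iff_lt hs ht

lemma IsClock.toReal_pos (hμ : IsClock μ) {s : ℝ} (hs : 0 < s) : 0 < (μ (Iio s)).toReal :=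
  ENNReal.toReal_pos (hμ.pos s hs).ne' (hμ.lt_top s).ne

theorem IsClock.setLIntegral_Ioi_rpow [NullSingletonClass μ] (hμ : IsClock μ) {s c : ℝ}
    (hs : 0 < s) (hc : 0 < c) :
    ∫⁻ y in Ioi s, μ (Iio y) ^ (-c - 1) ∂μ = (ENNReal.ofReal c)⁻¹ * μ (Iio s) ^ (-c) := by
  set b := (μ (Iio s)).toReal with hb
  have hb0 : 0 < b := hμ.toReal_pos hs
  calc ∫⁻ y in Ioi s, μ (Iio y) ^ (-c - 1) ∂μ
      = ∫⁻ y, (Ioi b).indicator (fun v => ENNReal.ofReal (v ^ (-c - 1))) (μ (Iio y)).toReal ∂μ := by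
        rw [← lintegral_indicator measurableSet_Ioi]
        refine lintegral_congr_ae ?_
        filter_upwards [ae_pos_of_null hμ.null] with y hy
        by_cases h : s < y
        · rw [indicator_of_mem (show y ∈ Ioi s from h), indicator_of_mem
            (show (μ (Iio y)).toReal ∈ Ioi b from (hμ.toReal_lt_iff hs.le hy.le).2 h),
            ← ENNReal.ofReal_rpow_of_pos (hμ.toReal_pos hy),
            ENNReal.ofReal_toReal (hμ.lt_top y).ne]
        · rw [indicator_of_notMem (show y ∉ Ioi s from h), indicator_of_notMem
            (show (μ (Iio y)).toReal ∉ Ioi b from fun h' =>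
              h ((hμ.toReal_lt_iff hs.le hy.le).1 h'))]
    _ = ∫⁻ v in Ioi b, ENNReal.ofReal (v ^ (-c - 1)) := by
        rw [hμ.lintegral_comp (k := (Ioi b).indicator fun v => ENNReal.ofReal (v ^ (-c - 1)))
          ((by fun_prop : Measurable fun v : ℝ => ENNReal.ofReal (v ^ (-c - 1))).indicator
            measurableSet_Ioi), lintegral_indicator measurableSet_Ioi,
          Measure.restrict_restrict measurableSet_Ioi, Ioi_inter_Ioi, max_eq_left hb0.le]
    _ = ENNReal.ofReal (b ^ (-c) / c) := by
        rw [← ofReal_integral_eq_lintegral_ofReal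
          (integrableOn_Ioi_rpow_of_lt (by linarith) hb0)
          ((ae_restrict_mem measurableSet_Ioi).mono fun v hv =>
            Real.rpow_nonneg (hb0.trans hv).le _), integral_Ioi_rpow_of_lt (by linarith) hb0]
        congr 1
        rw [sub_add_cancel, neg_div_neg_eq]
    _ = _ := by
        rw [div_eq_inv_mul, ENNReal.ofReal_mul (by positivity), ENNReal.ofReal_inv_of_pos hc,
          ← ENNReal.ofReal_rpow_of_pos hb0, hb, ENNReal.ofReal_toReal (hμ.lt_top s).ne]

theorem IsClock.setLIntegral_Iio_rpow [NullSingletonClass μ] (hμ : IsClock μ) {s c : ℝ}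
    (hs : 0 < s) (hc : 0 < c) :
    ∫⁻ y in Iio s, μ (Iio y) ^ (c - 1) ∂μ = (ENNReal.ofReal c)⁻¹ * μ (Iio s) ^ c := by
  set b := (μ (Iio s)).toReal with hb
  have hb0 : 0 < b := hμ.toReal_pos hs
  calc ∫⁻ y in Iio s, μ (Iio y) ^ (c - 1) ∂μ
      = ∫⁻ y, (Iio b).indicator (fun v => ENNReal.ofReal (v ^ (c - 1))) (μ (Iio y)).toReal ∂μ := by
        rw [← lintegral_indicator measurableSet_Iio]
        refine lintegral_congr_ae ?_
        filter_upwards [ae_pos_of_null hμ.null] with y hy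
        by_cases h : y < s
        · rw [indicator_of_mem (show y ∈ Iio s from h), indicator_of_mem
            (show (μ (Iio y)).toReal ∈ Iio b from (hμ.toReal_lt_iff hy.le hs.le).2 h),
            ← ENNReal.ofReal_rpow_of_pos (hμ.toReal_pos hy),
            ENNReal.ofReal_toReal (hμ.lt_top y).ne]
        · rw [indicator_of_notMem (show y ∉ Iio s from h), indicator_of_notMem
            (show (μ (Iio y)).toReal ∉ Iio b from fun h' =>
              h ((hμ.toReal_lt_iff hy.le hs.le).1 h'))]
    _ = ∫⁻ v in Ioc 0 b, ENNReal.ofReal (v ^ (c - 1)) := by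
        rw [hμ.lintegral_comp (k := (Iio b).indicator fun v => ENNReal.ofReal (v ^ (c - 1)))
          ((by fun_prop : Measurable fun v : ℝ => ENNReal.ofReal (v ^ (c - 1))).indicator
            measurableSet_Iio), lintegral_indicator measurableSet_Iio,
          Measure.restrict_restrict measurableSet_Iio, inter_comm, Ioi_inter_Iio,
          restrict_Ioo_eq_restrict_Ioc]
    _ = ENNReal.ofReal (b ^ c / c) := by
        have hint := (intervalIntegral.intervalIntegrable_rpow' (a := 0) (b := b)
          (r := c - 1) (by linarith))
        rw [intervalIntegrable_iff_integrableOn_Ioc_of_le hb0.le] at hint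
        rw [← ofReal_integral_eq_lintegral_ofReal hint
          ((ae_restrict_mem measurableSet_Ioc).mono fun v hv => Real.rpow_nonneg hv.1.le _),
          ← intervalIntegral.integral_of_le hb0.le, integral_rpow (Or.inl (by linarith)),
          sub_add_cancel, Real.zero_rpow hc.ne', sub_zero]
    _ = _ := by
        rw [div_eq_inv_mul, ENNReal.ofReal_mul (by positivity), ENNReal.ofReal_inv_of_pos hc,
          ← ENNReal.ofReal_rpow_of_pos hb0, hb, ENNReal.ofReal_toReal (hμ.lt_top s).ne]

end

section

variable {μ ω : Measure ℝ} {α : ℝ}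

/-! ### The gain for exponents below one -/

lemma IsClock.sigmaFinite [NullSingletonClass μ] (hμ : IsClock μ) : SigmaFinite μ := by
  refine ⟨⟨⟨fun n => Iio (n : ℝ), fun _ => trivial, fun n => hμ.lt_top n, ?_⟩⟩⟩
  exact iUnion_eq_univ_iff.2 fun s => exists_nat_gt s

lemma measurable_measure_Iio (ω : Measure ℝ) : Measurable fun s => ω (Iio s) :=
  Monotone.measurable fun _ _ h => measure_mono (Iio_subset_Iio h)

lemma rpow_neg_half_le {a b : ℝ≥0∞} (h : a ≤ b) :
    b ^ (-(1 / 2) : ℝ) ≤ a ^ (-(1 / 2) : ℝ) := by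
  rw [ENNReal.rpow_neg, ENNReal.rpow_neg]
  gcongr

/-- Interchange of the order of integration over the region `s < y`. -/
lemma lintegral_mul_setLIntegral_Ioi [SFinite ω] [SFinite μ] {a b : ℝ → ℝ≥0∞} (ha : Measurable a)
    (hb : Measurable b) :
    ∫⁻ s, b s * ∫⁻ y in Ioi s, a y ∂μ ∂ω = ∫⁻ y, a y * ∫⁻ s in Iio y, b s ∂ω ∂μ := by
  have hS : MeasurableSet {x : ℝ × ℝ | x.1 < x.2} := measurableSet_lt measurable_fst measurable_snd
  have hm : Measurable ({x : ℝ × ℝ | x.1 < x.2}.indicator fun x => b x.1 * a x.2) :=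
    Measurable.indicator (by fun_prop) hS
  calc ∫⁻ s, b s * ∫⁻ y in Ioi s, a y ∂μ ∂ω
      = ∫⁻ s, ∫⁻ y, {x : ℝ × ℝ | x.1 < x.2}.indicator (fun x => b x.1 * a x.2) (s, y) ∂μ ∂ω := by
        refine lintegral_congr fun s => ?_
        rw [← lintegral_const_mul _ ha, ← lintegral_indicator measurableSet_Ioi]
        rfl
    _ = ∫⁻ y, ∫⁻ s, {x : ℝ × ℝ | x.1 < x.2}.indicator (fun x => b x.1 * a x.2) (s, y) ∂ω ∂μ :=
        lintegral_lintegral_swap hm.aemeasurable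
    _ = _ := by
        refine lintegral_congr fun y => ?_
        rw [← lintegral_const_mul _ hb, ← lintegral_indicator measurableSet_Iio]
        refine lintegral_congr fun s => ?_
        simp only [indicator, mem_Iio, mem_ofPred_eq, mul_comm]

/-- For exponents `α < 1` the gain at `t` is at most a multiple of an integral over `(t, ∞)`.
The function `F` is replaced by its average `Q = Ψ⁻² ∫ F Ψ dμ`, where `Ψ s = μ (Iio s)`; this
has the same mass, dominates `F / 2`, and decays so slowly that `Q ^ α` is bounded by a tail
integral of itself. -/
theorem exists_gain_le_mul_lintegral [NullSingletonClass μ] [SFinite ω] (hμ : IsClock μ)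
    (hω : ω (Iic 0) = 0) (hα : 0 < α) (hα1 : α < 1) :
    ∃ C : ℝ≥0∞, C ≠ ∞ ∧ ∀ t, 0 ≤ t → gain μ ω α t
      ≤ C * (∫⁻ y in Ioi t, (ω (Iio y) / μ (Iio y)) ^ (1 - α)⁻¹ ∂μ) ^ (1 - α) := by
  have := hμ.sigmaFinite
  have hβ : 0 < 1 - α := by linarith
  have h2α : (2 : ℝ≥0∞) ^ α ≠ ∞ := ENNReal.rpow_ne_top_of_nonneg hα.le (by simp)
  refine ⟨2 ^ α * ENNReal.ofReal (2 * α), by finiteness, fun t ht => iSup₂_le fun F hF => ?_⟩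
  set Ψ : ℝ → ℝ≥0∞ := fun s => μ (Iio s) with hΨ
  have hΨm : Measurable Ψ := measurable_measure_Iio μ
  have hWm : Measurable fun s => ω (Iio s) := measurable_measure_Iio ω
  have hFm : Measurable F := hF.1.measurable
  have hΨ0 : ∀ s, 0 < s → Ψ s ≠ 0 := fun s hs => (hμ.pos s hs).ne'
  have hΨt : ∀ s, Ψ s ≠ ∞ := fun s => (hμ.lt_top s).ne
  let M : ℝ → ℝ≥0∞ := fun s => ∫⁻ r in Iio s, F r * Ψ r ∂μ
  have hMmono : Monotone M := fun s r h =>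
    lintegral_mono_set (Iio_subset_Iio h)
  have hMm : Measurable M := hMmono.measurable
  let Q : ℝ → ℝ≥0∞ := fun s => Ψ s ^ (-2 : ℝ) * M s
  have hQm : Measurable Q := (hΨm.pow_const _).mul hMm
  have hQ1 : ∫⁻ s, Q s ∂μ ≤ 1 := by
    calc ∫⁻ s, Q s ∂μ = ∫⁻ r, F r * Ψ r * ∫⁻ s in Ioi r, Ψ s ^ (-2 : ℝ) ∂μ ∂μ :=
          (lintegral_mul_setLIntegral_Ioi (hΨm.pow_const _) (hFm.mul hΨm)).symm
      _ = ∫⁻ r, F r ∂μ := by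
          refine lintegral_congr_ae ?_
          filter_upwards [ae_pos_of_null hμ.null] with r hr
          have := hμ.setLIntegral_Ioi_rpow hr one_pos
          norm_num at this
          rw [this, ENNReal.rpow_neg_one, mul_assoc, ENNReal.mul_inv_cancel (hΨ0 r hr) (hΨt r),
            mul_one]
      _ ≤ 1 := hF.2.2
  have hFQ : ∀ r, 0 < r → F r ≤ 2 * Q r := by
    intro r hr
    have h1 : F r * (2⁻¹ * Ψ r ^ (2 : ℝ)) ≤ M r := by
      have := hμ.setLIntegral_Iio_rpow hr two_pos
      norm_num at this
      rw [ENNReal.rpow_ofNat, ← this, ← lintegral_const_mul _ hΨm]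
      refine setLIntegral_mono' measurableSet_Iio fun s hs => ?_
      gcongr
      exact hF.1 (le_of_lt hs)
    have h2 : Ψ r ^ (-2 : ℝ) * Ψ r ^ (2 : ℝ) = 1 := by
      rw [← ENNReal.rpow_add _ _ (hΨ0 r hr) (hΨt r)]; norm_num
    calc F r = (2 * 2⁻¹) * (Ψ r ^ (-2 : ℝ) * Ψ r ^ (2 : ℝ)) * F r := by
          rw [h2, ENNReal.mul_inv_cancel (by simp) (by simp)]; simp
      _ = 2 * (Ψ r ^ (-2 : ℝ) * (F r * (2⁻¹ * Ψ r ^ (2 : ℝ)))) := by ring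
      _ ≤ _ := by simp only [Q]; gcongr
  have htail : ∀ r, 0 < r →
      Q r ^ α ≤ ENNReal.ofReal (2 * α) * ∫⁻ y in Ioi r, Q y ^ α * (Ψ y)⁻¹ ∂μ := by
    intro r hr
    have h1 : M r ^ α * ∫⁻ y in Ioi r, Ψ y ^ (-(2 * α) - 1) ∂μ
        ≤ ∫⁻ y in Ioi r, Q y ^ α * (Ψ y)⁻¹ ∂μ := by
      rw [← lintegral_const_mul _ (hΨm.pow_const _)]
      refine setLIntegral_mono' measurableSet_Ioi fun y (hy : r < y) => ?_
      rw [ENNReal.mul_rpow_of_nonneg _ _ hα.le, ← ENNReal.rpow_mul, sub_eq_add_neg,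
        ENNReal.rpow_add _ _ (hΨ0 y (hr.trans hy)) (hΨt y), ENNReal.rpow_neg_one, neg_mul,
        ← mul_assoc, mul_comm (M r ^ α)]
      gcongr
      exact hMmono hy.le
    rw [hμ.setLIntegral_Ioi_rpow hr (by positivity : 0 < 2 * α)] at h1
    calc Q r ^ α = ENNReal.ofReal (2 * α) * (ENNReal.ofReal (2 * α))⁻¹
          * (M r ^ α * Ψ r ^ (-(2 * α))) := by
          rw [ENNReal.mul_inv_cancel (by simpa using hα) ENNReal.ofReal_ne_top, one_mul,
            ENNReal.mul_rpow_of_nonneg _ _ hα.le, ← ENNReal.rpow_mul, neg_mul, mul_comm]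
      _ = ENNReal.ofReal (2 * α)
          * (M r ^ α * ((ENNReal.ofReal (2 * α))⁻¹ * Ψ r ^ (-(2 * α)))) := by ring
      _ ≤ _ := by gcongr
  let g : ℝ → ℝ≥0∞ := (Ioi t).indicator fun y => Q y ^ α * (Ψ y)⁻¹
  have hgm : Measurable g := ((hQm.pow_const _).mul hΨm.inv).indicator measurableSet_Ioi
  have hFg : ∀ s, 0 < s →
      F s ^ α ≤ 2 ^ α * ENNReal.ofReal (2 * α) * (1 * ∫⁻ y in Ioi s, g y ∂μ) := by
    intro s hs
    have hr : 0 < max s t := lt_max_of_lt_left hs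
    have hFs : F s = F (max s t) := by
      rcases le_total s t with h | h
      · rw [max_eq_right h, hF.2.1 s h]
      · rw [max_eq_left h]
    have hint : ∫⁻ y in Ioi s, g y ∂μ = ∫⁻ y in Ioi (max s t), Q y ^ α * (Ψ y)⁻¹ ∂μ := by
      rw [lintegral_indicator measurableSet_Ioi, Measure.restrict_restrict measurableSet_Ioi,
        Ioi_inter_Ioi, max_comm]
    rw [hint, one_mul, hFs, mul_assoc]
    calc F (max s t) ^ α ≤ (2 * Q (max s t)) ^ α := by gcongr; exact hFQ _ hr
      _ = 2 ^ α * Q (max s t) ^ α := ENNReal.mul_rpow_of_nonneg _ _ hα.le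
      _ ≤ _ := by gcongr; exact htail _ hr
  calc ∫⁻ s, F s ^ α ∂ω
      ≤ ∫⁻ s, 2 ^ α * ENNReal.ofReal (2 * α) * (1 * ∫⁻ y in Ioi s, g y ∂μ) ∂ω := by
        refine lintegral_mono_ae ?_
        filter_upwards [ae_pos_of_null hω] with s hs using hFg s hs
    _ = 2 ^ α * ENNReal.ofReal (2 * α) * ∫⁻ y, g y * ∫⁻ s in Iio y, 1 ∂ω ∂μ := by
        rw [lintegral_const_mul' _ _ (by finiteness),
          lintegral_mul_setLIntegral_Ioi hgm measurable_const]
    _ = 2 ^ α * ENNReal.ofReal (2 * α) *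
          ∫⁻ y in Ioi t, Q y ^ α * ((ω (Iio y) / Ψ y) ^ (1 - α)⁻¹) ^ (1 - α) ∂μ := by
        rw [← lintegral_indicator measurableSet_Ioi]
        congr 2 with y
        by_cases hy : y ∈ Ioi t
        · simp only [g, indicator_of_mem hy, setLIntegral_one]
          rw [ENNReal.rpow_inv_rpow hβ.ne', div_eq_mul_inv]
          ring
        · simp only [g, indicator_of_notMem hy, zero_mul]
    _ ≤ 2 ^ α * ENNReal.ofReal (2 * α) * ((∫⁻ y in Ioi t, Q y ∂μ) ^ α *
          (∫⁻ y in Ioi t, (ω (Iio y) / Ψ y) ^ (1 - α)⁻¹ ∂μ) ^ (1 - α)) := by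
        gcongr
        exact ENNReal.lintegral_mul_norm_pow_le hQm.aemeasurable
          ((hWm.div hΨm).pow_const _).aemeasurable hα.le hβ.le (by ring)
    _ ≤ 2 ^ α * ENNReal.ofReal (2 * α) * (1 ^ α *
          (∫⁻ y in Ioi t, (ω (Iio y) / Ψ y) ^ (1 - α)⁻¹ ∂μ) ^ (1 - α)) := by
        gcongr
        exact (setLIntegral_le_lintegral _ _).trans hQ1
    _ = _ := by rw [ENNReal.one_rpow, one_mul]

/-- The test function realizing the gain for `α < 1`, for a function `V` in place of the
distribution function of `ω`; the bound on `V` makes the mass of the test function finite. -/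
theorem rpow_lintegral_le_mul_gain [NullSingletonClass μ] [SFinite ω] (hμ : IsClock μ)
    (hω : ω (Iic 0) = 0) (hα : 0 < α) (hα1 : α < 1) {t : ℝ} (ht : 0 ≤ t) {V : ℝ → ℝ≥0∞}
    (hVm : Measurable V) (hV : ∀ s, V s ≤ ω (Iio s)) {ε N : ℝ} {L : ℝ≥0∞} (hε : 0 < ε) (hL : L ≠ ∞)
    (hVL : ∀ s, V s ≤ (Icc ε N).indicator (fun _ => L) s) :
    (∫⁻ y in Ioi t, (V y / μ (Iio y)) ^ (1 - α)⁻¹ ∂μ) ^ (1 - α)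
      ≤ ((ENNReal.ofReal (α * (1 - α)⁻¹ / 2))⁻¹ ^ (1 - α) * 2 ^ α) * gain μ ω α t := by
  have := hμ.sigmaFinite
  have hβ : 0 < 1 - α := by linarith
  set κ := (1 - α)⁻¹ with hκ
  have hκ0 : 0 < κ := inv_pos.2 hβ
  have hκβ : κ * (1 - α) = 1 := inv_mul_cancel₀ hβ.ne'
  have hγ : 0 < α * κ / 2 := by positivity
  set Ψ : ℝ → ℝ≥0∞ := fun s => μ (Iio s) with hΨ
  have hΨm : Measurable Ψ := measurable_measure_Iio μ
  have hΨmono : Monotone Ψ := fun s r h => measure_mono (Iio_subset_Iio h)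
  have hΨ0 : ∀ s, 0 < s → Ψ s ≠ 0 := fun s hs => (hμ.pos s hs).ne'
  have hΨt : ∀ s, Ψ s ≠ ∞ := fun s => (hμ.lt_top s).ne
  set I := ∫⁻ y in Ioi t, (V y / Ψ y) ^ κ ∂μ with hI
  have hItop : I ≠ ∞ := by
    have hle : I ≤ ∫⁻ y, (Icc ε N).indicator (fun _ => (L / Ψ ε) ^ κ) y ∂μ := by
      refine (setLIntegral_le_lintegral _ _).trans (lintegral_mono fun y => ?_)
      by_cases hy : y ∈ Icc ε N
      · rw [indicator_of_mem hy]
        have := hVL y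
        rw [indicator_of_mem hy] at this
        gcongr
        exact hΨmono hy.1
      · rw [indicator_of_notMem hy]
        have := hVL y
        rw [indicator_of_notMem hy] at this
        rw [nonpos_iff_eq_zero.1 this, ENNReal.zero_div, ENNReal.zero_rpow_of_pos hκ0]
    refine ne_top_of_le_ne_top ?_ hle
    rw [lintegral_indicator_const measurableSet_Icc]
    refine ENNReal.mul_ne_top (ENNReal.rpow_ne_top_of_nonneg hκ0.le
      (ENNReal.div_ne_top hL (hΨ0 ε hε))) (ne_top_of_le_ne_top (hΨt (N + 1)) (measure_mono ?_))
    exact fun y hy => show y < N + 1 by linarith [hy.2]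
  rcases eq_or_ne I 0 with hI0 | hI0
  · rw [hI0, ENNReal.zero_rpow_of_pos hβ]; exact zero_le
  let a : ℝ → ℝ≥0∞ := fun y => V y ^ κ * Ψ y ^ (-κ - 1 / 2)
  have ham : Measurable a := (hVm.pow_const _).mul (hΨm.pow_const _)
  let F : ℝ → ℝ≥0∞ := fun s => Ψ (max s t) ^ (-(1 / 2) : ℝ) * ∫⁻ y in Ioi (max s t), a y ∂μ
  have hF : Antitone F := fun s r h => by
    have hsr : max s t ≤ max r t := max_le_max_right _ h
    exact mul_le_mul' (rpow_neg_half_le (hΨmono hsr))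
      (lintegral_mono_set (Ioi_subset_Ioi hsr))
  have hFc : ∀ s ≤ t, F s = F t := fun s hs => by simp only [F, max_eq_right hs, max_self]
  have htrunc : ∀ (k : ℝ → ℝ≥0∞) s,
      ∫⁻ y in Ioi s, (Ioi t).indicator k y ∂μ = ∫⁻ y in Ioi (max s t), k y ∂μ := fun k s => by
    rw [lintegral_indicator measurableSet_Ioi, Measure.restrict_restrict measurableSet_Ioi,
      Ioi_inter_Ioi, max_comm]
  have hFI : ∫⁻ s, F s ∂μ ≤ 2 * I := by
    calc ∫⁻ s, F s ∂μ
        ≤ ∫⁻ s, Ψ s ^ (-(1 / 2) : ℝ) * ∫⁻ y in Ioi s, (Ioi t).indicator a y ∂μ ∂μ := by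
          refine lintegral_mono fun s => ?_
          rw [htrunc]
          exact mul_le_mul_left (rpow_neg_half_le
            (hΨmono (le_max_left _ _))) _
      _ = ∫⁻ y, (Ioi t).indicator a y * ∫⁻ s in Iio y, Ψ s ^ (-(1 / 2) : ℝ) ∂μ ∂μ :=
          lintegral_mul_setLIntegral_Ioi (ham.indicator measurableSet_Ioi) (hΨm.pow_const _)
      _ = ∫⁻ y in Ioi t, 2 * (V y / Ψ y) ^ κ ∂μ := by
          rw [← lintegral_indicator measurableSet_Ioi]
          congr 1 with y
          by_cases hy : y ∈ Ioi t
          · have hy0 : 0 < y := ht.trans_lt hy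
            have h1 := hμ.setLIntegral_Iio_rpow hy0 (by norm_num : (0 : ℝ) < 1 / 2)
            rw [show (1 / 2 - 1 : ℝ) = -(1 / 2) by norm_num] at h1
            have h2 : (ENNReal.ofReal (1 / 2))⁻¹ = 2 := by
              rw [one_div, ENNReal.ofReal_inv_of_pos two_pos, inv_inv]; simp
            rw [indicator_of_mem hy, indicator_of_mem hy, h1, h2, ENNReal.div_eq_inv_mul,
              ENNReal.mul_rpow_of_nonneg _ _ hκ0.le, ENNReal.inv_rpow, ← ENNReal.rpow_neg]
            have h3 : Ψ y ^ (-κ - 1 / 2) * Ψ y ^ (1 / 2 : ℝ) = Ψ y ^ (-κ) := by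
              rw [← ENNReal.rpow_add _ _ (hΨ0 y hy0) (hΨt y)]; congr 1; ring
            calc V y ^ κ * Ψ y ^ (-κ - 1 / 2) * (2 * μ (Iio y) ^ (1 / 2 : ℝ))
                = 2 * ((Ψ y ^ (-κ - 1 / 2) * Ψ y ^ (1 / 2 : ℝ)) * V y ^ κ) := by
                  simp only [hΨ]; ring
              _ = _ := by rw [h3]
          · simp only [indicator_of_notMem hy, zero_mul]
      _ = 2 * I := lintegral_const_mul _ ((hVm.div hΨm).pow_const _)
  let g : ℝ → ℝ≥0∞ := fun y => V y ^ (α * κ) * Ψ y ^ (-κ)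
  have hgm : Measurable g := (hVm.pow_const _).mul (hΨm.pow_const _)
  have hg : ∀ s, 0 < s → ∫⁻ y in Ioi (max s t), g y ∂μ
      ≤ (ENNReal.ofReal (α * κ / 2))⁻¹ ^ (1 - α) * F s ^ α := by
    intro s hs
    have hr : 0 < max s t := lt_max_of_lt_left hs
    calc ∫⁻ y in Ioi (max s t), g y ∂μ
        = ∫⁻ y in Ioi (max s t), a y ^ α * (Ψ y ^ (-(α * κ / 2) - 1)) ^ (1 - α) ∂μ := by
          refine setLIntegral_congr_fun measurableSet_Ioi fun y hy => ?_
          have hy0 : 0 < y := hr.trans hy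
          simp only [g, a]
          rw [ENNReal.mul_rpow_of_nonneg _ _ hα.le, ← ENNReal.rpow_mul, ← ENNReal.rpow_mul,
            ← ENNReal.rpow_mul, mul_assoc, ← ENNReal.rpow_add _ _ (hΨ0 y hy0) (hΨt y),
            mul_comm κ α]
          congr 2
          linear_combination (α / 2 - 1) * hκβ
      _ ≤ (∫⁻ y in Ioi (max s t), a y ∂μ) ^ α *
          (∫⁻ y in Ioi (max s t), Ψ y ^ (-(α * κ / 2) - 1) ∂μ) ^ (1 - α) :=
          ENNReal.lintegral_mul_norm_pow_le ham.aemeasurable (hΨm.pow_const _).aemeasurable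
            hα.le hβ.le (by ring)
      _ = (∫⁻ y in Ioi (max s t), a y ∂μ) ^ α *
          ((ENNReal.ofReal (α * κ / 2))⁻¹ ^ (1 - α) * (Ψ (max s t) ^ (-(1 / 2) : ℝ)) ^ α) := by
          rw [hμ.setLIntegral_Ioi_rpow hr hγ, ENNReal.mul_rpow_of_nonneg _ _ hβ.le,
            ← ENNReal.rpow_mul, ← ENNReal.rpow_mul]
          congr 3
          linear_combination (-(α / 2)) * hκβ
      _ = _ := by
          simp only [F]
          rw [ENNReal.mul_rpow_of_nonneg _ _ hα.le]
          ring
  set k := (ENNReal.ofReal (α * κ / 2))⁻¹ ^ (1 - α) with hk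
  have hktop : k ≠ ∞ := ENNReal.rpow_ne_top_of_nonneg hβ.le
    (ENNReal.inv_ne_top.2 (by simpa using hγ))
  have hIF : I ≤ k * ∫⁻ s, F s ^ α ∂ω := by
    calc I ≤ ∫⁻ y, (Ioi t).indicator g y * ∫⁻ s in Iio y, 1 ∂ω ∂μ := by
          rw [hI, ← lintegral_indicator measurableSet_Ioi]
          refine lintegral_mono fun y => ?_
          by_cases hy : y ∈ Ioi t
          · rw [indicator_of_mem hy, indicator_of_mem hy, setLIntegral_one,
              ENNReal.div_eq_inv_mul, ENNReal.mul_rpow_of_nonneg _ _ hκ0.le, ENNReal.inv_rpow,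
              ← ENNReal.rpow_neg]
            have h1 : V y ^ κ = V y ^ (α * κ) * V y := by
              conv_rhs => rw [← ENNReal.rpow_one (V y), ← ENNReal.rpow_mul, one_mul]
              rw [← ENNReal.rpow_add_of_nonneg _ _ (by positivity) zero_le_one]
              congr 1
              linear_combination hκβ
            calc Ψ y ^ (-κ) * V y ^ κ = V y ^ (α * κ) * Ψ y ^ (-κ) * V y := by rw [h1]; ring
              _ ≤ _ := by simp only [g]; gcongr; exact hV y
          · simp only [indicator_of_notMem hy, zero_mul, le_refl]
      _ = ∫⁻ s, 1 * ∫⁻ y in Ioi s, (Ioi t).indicator g y ∂μ ∂ω :=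
          (lintegral_mul_setLIntegral_Ioi (hgm.indicator measurableSet_Ioi) measurable_const).symm
      _ ≤ ∫⁻ s, k * F s ^ α ∂ω := by
          refine lintegral_mono_ae ?_
          filter_upwards [ae_pos_of_null hω] with s hs
          rw [one_mul, htrunc]
          exact hg s hs
      _ = _ := lintegral_const_mul' _ _ hktop
  have hgain := lintegral_rpow_le_gain (ω := ω) hα hF hFc (mul_ne_zero two_ne_zero hI0)
    (ENNReal.mul_ne_top (by simp) hItop) hFI
  have hIα : I ^ α * I ^ (1 - α) ≤ I ^ α * (k * 2 ^ α * gain μ ω α t) := by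
    rw [← ENNReal.rpow_add _ _ hI0 hItop, add_sub_cancel, ENNReal.rpow_one]
    calc I ≤ k * ((2 * I) ^ α * gain μ ω α t) := hIF.trans (by gcongr)
      _ = _ := by rw [ENNReal.mul_rpow_of_nonneg _ _ hα.le]; ring
  rwa [ENNReal.mul_le_mul_iff_right (ENNReal.rpow_pos (pos_iff_ne_zero.2 hI0) hItop).ne'
    (ENNReal.rpow_ne_top_of_nonneg hα.le hItop)] at hIα

theorem exists_lintegral_le_mul_gain [NullSingletonClass μ] [SFinite ω] (hμ : IsClock μ)
    (hω : ω (Iic 0) = 0) (hα : 0 < α) (hα1 : α < 1) :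
    ∃ C : ℝ≥0∞, C ≠ ∞ ∧ ∀ t, 0 ≤ t →
      (∫⁻ y in Ioi t, (ω (Iio y) / μ (Iio y)) ^ (1 - α)⁻¹ ∂μ) ^ (1 - α) ≤ C * gain μ ω α t := by
  have hβ : 0 < 1 - α := by linarith
  have hγ : 0 < α * (1 - α)⁻¹ / 2 := by positivity
  have hC : (ENNReal.ofReal (α * (1 - α)⁻¹ / 2))⁻¹ ^ (1 - α) * 2 ^ α ≠ ∞ :=
    ENNReal.mul_ne_top (ENNReal.rpow_ne_top_of_nonneg hβ.le (ENNReal.inv_ne_top.2 (by simpa using hγ)))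
      (ENNReal.rpow_ne_top_of_nonneg hα.le (by simp))
  refine ⟨_, hC, fun t ht => ?_⟩
  have hWm : Measurable fun s => ω (Iio s) := measurable_measure_Iio ω
  have hΨm : Measurable fun s => μ (Iio s) := measurable_measure_Iio μ
  -- Exhaustion of the distribution function of `ω` by bounded functions of bounded support.
  let E : ℕ → Set ℝ := fun n => Icc (1 / ((n : ℝ) + 1)) ((n : ℝ) + 1)
  let V : ℕ → ℝ → ℝ≥0∞ := fun n => (E n).indicator fun s => min (ω (Iio s)) n
  have hE : Monotone E := fun n k h => Icc_subset_Icc (by gcongr) (by gcongr)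
  have hVm : ∀ n, Measurable (V n) := fun n =>
    (hWm.min measurable_const).indicator measurableSet_Icc
  have hVmono : Monotone V := fun n k h s => by
    refine (indicator_le_indicator_of_subset (hE h) (fun _ => zero_le) s).trans ?_
    refine indicator_le_indicator ?_
    gcongr
  have hlim : Tendsto (fun n => ∫⁻ y in Ioi t, (V n y / μ (Iio y)) ^ (1 - α)⁻¹ ∂μ) atTop
      (𝓝 (∫⁻ y in Ioi t, (ω (Iio y) / μ (Iio y)) ^ (1 - α)⁻¹ ∂μ)) := by
    refine lintegral_tendsto_of_tendsto_of_monotone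
      (fun n => (((hVm n).div hΨm).pow_const _).aemeasurable)
      (Eventually.of_forall fun y n k h => ?_) ?_
    · exact ENNReal.rpow_le_rpow (ENNReal.div_le_div_right (hVmono h y) _) (inv_pos.2 hβ).le
    · filter_upwards [ae_restrict_mem measurableSet_Ioi] with y hy
      have hy0 : 0 < y := ht.trans_lt hy
      have hVy : Tendsto (fun n => V n y) atTop (𝓝 (ω (Iio y))) := by
        have h1 : Tendsto (fun n : ℕ => min (ω (Iio y)) (n : ℝ≥0∞)) atTop (𝓝 (ω (Iio y))) := by
          simpa using (tendsto_const_nhds (x := ω (Iio y))).min ENNReal.tendsto_nat_nhds_top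
        refine h1.congr' ?_
        obtain ⟨n₀, hn₀⟩ := exists_nat_one_div_lt hy0
        obtain ⟨k₀, hk₀⟩ := exists_nat_gt y
        filter_upwards [eventually_ge_atTop (max n₀ k₀)] with n hn
        have h2 : (n₀ : ℝ) ≤ n := Nat.cast_le.2 ((le_max_left _ _).trans hn)
        have h3 : (k₀ : ℝ) ≤ n := Nat.cast_le.2 ((le_max_right _ _).trans hn)
        have hyE : y ∈ E n := ⟨le_trans (by gcongr) hn₀.le, by linarith⟩
        simp only [V, indicator_of_mem hyE]
      simp_rw [div_eq_mul_inv]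
      exact (ENNReal.continuous_rpow_const.tendsto _).comp (ENNReal.Tendsto.mul_const hVy
        (Or.inr (ENNReal.inv_ne_top.2 (hμ.pos y hy0).ne')))
  refine le_of_tendsto' ((ENNReal.continuous_rpow_const.tendsto _).comp hlim) fun n => ?_
  refine rpow_lintegral_le_mul_gain hμ hω hα hα1 ht (hVm n) (fun s => ?_)
    (ε := 1 / ((n : ℝ) + 1)) (N := (n : ℝ) + 1) (L := n) (by positivity) (by simp) fun s => ?_
  · exact (indicator_le_self _ _ s).trans (min_le_left _ _)
  · exact indicator_le_indicator (min_le_right _ _)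

end

section

/-! ### Functions with prescribed rearrangement -/

lemma abs_coe_ennreal (x : ℝ≥0∞) : (x : EReal).abs = x := by
  induction x with
  | top => simp
  | coe x =>
    have h : ((x : ℝ≥0∞) : EReal) = ((x : ℝ) : EReal) := rfl
    rw [h, EReal.abs_def, NNReal.abs_eq]
    exact ENNReal.ofReal_coe_nnreal

lemma antitone_rearrangement {n : ℕ} (f : EuclideanSpace ℝ (Fin n) → EReal) :
    Antitone (rearrangement f) := fun _ _ h =>
  sInf_le_sInf fun _ hl => ⟨hl.1, hl.2.trans (ENNReal.ofReal_le_ofReal h)⟩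

/-- Each non-increasing function is, up to countably many points, the rearrangement of a radial
function. -/
theorem exists_rearrangement_ae_eq {n : ℕ} (hn : 1 ≤ n) {g : ℝ → ℝ≥0∞} (hg : Antitone g) :
    ∃ f : EuclideanSpace ℝ (Fin n) → EReal, Measurable f ∧
      ∀ᵐ t ∂volume.restrict (Ioi (0 : ℝ)), rearrangement f t = g t := by
  have : Nonempty (Fin n) := ⟨⟨0, hn⟩⟩
  set v : ℝ≥0∞ := volume (Metric.ball (0 : EuclideanSpace ℝ (Fin n)) 1) with hv
  have hv0 : v ≠ 0 := (Metric.measure_ball_pos volume _ one_pos).ne'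
  have hvt : v ≠ ∞ := measure_ball_lt_top.ne
  set c : ℝ := v.toReal with hc
  have hc0 : 0 < c := ENNReal.toReal_pos hv0 hvt
  have hn0 : n ≠ 0 := by omega
  have hball : ∀ t : ℝ, 0 ≤ t →
      volume {x : EuclideanSpace ℝ (Fin n) | c * ‖x‖ ^ n < t} = ENNReal.ofReal t := by
    intro t ht
    set ρ : ℝ := (t / c) ^ ((n : ℝ)⁻¹) with hρ
    have hρ0 : 0 ≤ ρ := by positivity
    have hρn : ρ ^ n = t / c := Real.rpow_inv_natCast_pow (by positivity) hn0
    have hset : {x : EuclideanSpace ℝ (Fin n) | c * ‖x‖ ^ n < t} = Metric.ball 0 ρ := by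
      ext x
      rw [mem_ball_zero_iff, mem_ofPred_eq, ← pow_lt_pow_iff_left₀ (norm_nonneg x) hρ0 hn0, hρn,
        lt_div_iff₀ hc0, mul_comm]
    rw [hset, Measure.addHaar_ball _ _ hρ0, finrank_euclideanSpace, Fintype.card_fin, hρn, ← hv,
      ← ENNReal.ofReal_toReal hvt, ← hc, ← ENNReal.ofReal_mul (by positivity),
      div_mul_cancel₀ _ hc0.ne']
  let f : EuclideanSpace ℝ (Fin n) → EReal := fun x => (g (c * ‖x‖ ^ n) : EReal)
  have hdist : ∀ l, distribution f l
      = volume {x : EuclideanSpace ℝ (Fin n) | l < g (c * ‖x‖ ^ n)} := fun l => by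
    simp only [distribution, f, abs_coe_ennreal]
  have upper : ∀ t, 0 < t → rearrangement f t ≤ g t := by
    intro t ht
    refine le_of_forall_gt_imp_ge_of_dense fun l hl => sInf_le ⟨zero_le.trans_lt hl, ?_⟩
    rw [hdist, ← hball t ht.le]
    refine measure_mono fun x (hx : l < g (c * ‖x‖ ^ n)) => ?_
    by_contra hcon
    have hcon : t ≤ c * ‖x‖ ^ n := not_lt.1 hcon
    exact absurd ((hl.trans hx).trans_le (hg hcon)) (lt_irrefl _)
  have lower : ∀ t, 0 < t → ∀ s > t, g s ≤ rearrangement f t := by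
    intro t ht s hs
    refine le_sInf fun l hl => ?_
    by_contra hcon
    have h1 : ENNReal.ofReal s ≤ distribution f l := by
      rw [hdist, ← hball s (ht.trans hs).le]
      exact measure_mono fun x (hx : c * ‖x‖ ^ n < s) =>
        show l < g (c * ‖x‖ ^ n) from (not_le.1 hcon).trans_le (hg hx.le)
    exact absurd ((ENNReal.ofReal_lt_ofReal_iff (ht.trans hs)).2 hs)
      (not_lt.2 (h1.trans hl.2))
  refine ⟨f, (hg.measurable.comp (by fun_prop)).coe_ereal_ennreal, ?_⟩
  have hcount : ∀ᵐ t ∂volume.restrict (Ioi (0 : ℝ)), ContinuousAt g t :=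
    ae_restrict_of_ae (ae_iff.2 (hg.countable_not_continuousAt.measure_zero volume))
  filter_upwards [hcount, ae_restrict_mem measurableSet_Ioi] with t hct ht
  refine le_antisymm (upper t ht) (le_of_tendsto (hct.mono_left nhdsWithin_le_nhds) (?_ :
    ∀ᶠ s in 𝓝[>] t, g s ≤ rearrangement f t))
  filter_upwards [self_mem_nhdsWithin] with s hs using lower t ht s hs

end

section

/-! ### Weighted measures on the half-line -/

/-- The measure `v ^ p ds` on `(0, ∞)`. -/
noncomputable def weighted (p : ℝ) (v : ℝ → ℝ≥0∞) : Measure ℝ :=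
  (volume.restrict (Ioi 0)).withDensity fun s => v s ^ p

variable {p q : ℝ} {ψ w : ℝ → ℝ≥0∞}

instance (p : ℝ) (v : ℝ → ℝ≥0∞) : SFinite (weighted p v) := by
  unfold weighted; infer_instance

instance (p : ℝ) (v : ℝ → ℝ≥0∞) : NullSingletonClass (weighted p v) :=
  ⟨fun x => withDensity_absolutelyContinuous _ _ (measure_singleton x)⟩

lemma weighted_Iic_zero (p : ℝ) (v : ℝ → ℝ≥0∞) : weighted p v (Iic 0) = 0 := by
  refine withDensity_absolutelyContinuous _ _ ?_
  rw [Measure.restrict_apply measurableSet_Iic, Iic_inter_Ioi, Ioc_self, measure_empty]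

lemma setLIntegral_weighted {v : ℝ → ℝ≥0∞} (hv : AEMeasurable v (volume.restrict (Ioi 0)))
    {S : Set ℝ} (hS : MeasurableSet S) {g : ℝ → ℝ≥0∞} (hg : Measurable g) :
    ∫⁻ s in S, g s ∂(weighted p v) = ∫⁻ s in S ∩ Ioi 0, v s ^ p * g s := by
  rw [weighted, restrict_withDensity hS, Measure.restrict_restrict hS,
    lintegral_withDensity_eq_lintegral_mul₀ _ hg.aemeasurable]
  · rfl
  · exact (hv.mono_set inter_subset_right).pow_const _

lemma weighted_Iio (p : ℝ) (v : ℝ → ℝ≥0∞) (t : ℝ) :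
    weighted p v (Iio t) = ∫⁻ s in Ioo 0 t, v s ^ p := by
  rw [weighted, withDensity_apply _ measurableSet_Iio,
    Measure.restrict_restrict measurableSet_Iio, inter_comm, Ioi_inter_Iio]

lemma lpOn_mul_eq (hp : 0 < p) {v : ℝ → ℝ≥0∞} (hv : AEMeasurable v (volume.restrict (Ioi 0)))
    {g : ℝ → ℝ≥0∞} (hg : Measurable g) (r : ℝ) :
    lpOn p (fun t => v t * g t) (Ioo 0 r) = (∫⁻ s in Iio r, g s ^ p ∂(weighted p v)) ^ (1 / p) := by
  rw [setLIntegral_weighted hv measurableSet_Iio (hg.pow_const _), lpOn, inter_comm, Ioi_inter_Iio]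
  simp_rw [ENNReal.mul_rpow_of_nonneg _ _ hp.le]

lemma lambdaNorm_eq {n : ℕ} (hq : 0 < q) (hw : AEMeasurable w (volume.restrict (Ioi 0)))
    (f : EuclideanSpace ℝ (Fin n) → EReal) :
    lambdaNorm q w f = (∫⁻ s, rearrangement f s ^ q ∂(weighted q w)) ^ (1 / q) := by
  have h := setLIntegral_weighted (p := q) hw MeasurableSet.univ
    ((antitone_rearrangement f).measurable.pow_const q)
  rw [Measure.restrict_univ, univ_inter] at h
  rw [h, lambdaNorm, lpOn]
  simp_rw [ENNReal.mul_rpow_of_nonneg _ _ hq.le]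

lemma Psi_eq (hq : 0 < q) (ψ : ℝ → ℝ≥0∞) :
    Psi p q ψ = scale (weighted p ψ) (q / p) := by
  ext t
  rw [Psi, lpOn, scale, weighted_Iio, one_div_div]
  simp_rw [← ENNReal.rpow_mul, mul_div_cancel₀ p hq.ne']

lemma primitivePow_eq (q : ℝ) (w : ℝ → ℝ≥0∞) (t : ℝ) :
    primitivePow q w t = weighted q w (Iio t) := (weighted_Iio q w t).symm

lemma isClock_weighted (hp : 0 < p) (hq : 0 < q) (hΨ : IsAdmissible (Psi p q ψ)) :
    IsClock (weighted p ψ) := by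
  have hpq : 0 < p / q := by positivity
  have hpow : ∀ t, weighted p ψ (Iio t) = Psi p q ψ t ^ (p / q) := fun t => by
    rw [Psi_eq hq, scale, ← ENNReal.rpow_mul, div_mul_div_cancel₀ hp.ne', div_self hq.ne',
      ENNReal.rpow_one]
  have hneg : ∀ t ≤ 0, weighted p ψ (Iio t) = 0 := fun t ht =>
    measure_mono_null (fun s hs => (lt_of_lt_of_le hs ht).le) (weighted_Iic_zero p ψ)
  have hmax : ∀ t, weighted p ψ (Iio t) = Psi p q ψ (max t 0) ^ (p / q) := fun t => by
    rcases le_total t 0 with h | h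
    · rw [max_eq_right h, hneg t h, ← hpow, hneg 0 le_rfl]
    · rw [max_eq_left h, hpow]
  refine ⟨weighted_Iic_zero p ψ, fun t => ?_, ?_, ?_, ?_⟩
  · rw [hmax]
    exact ENNReal.rpow_lt_top_of_nonneg hpq.le (hΨ.finite _ (mem_Ici.2 (le_max_right _ _))).ne
  · intro s hs t ht h
    simp only [hpow]
    exact ENNReal.rpow_lt_rpow (hΨ.strictMonoOn hs ht h) hpq
  · simp_rw [hmax]
    exact ENNReal.continuous_rpow_const.comp
      (hΨ.continuousOn.comp_continuous (by fun_prop) fun t => mem_Ici.2 (le_max_right _ _))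
  · simp_rw [hpow]
    have h := (ENNReal.continuous_rpow_const (y := p / q)).tendsto ∞
    rw [ENNReal.top_rpow_of_pos hpq] at h
    exact h.comp hΨ.tendsto_atTop

/-! ### The embedding and the integral of the gain -/

/-- The bound under the growth condition is homogeneous in the constant of that condition. -/
lemma lintegral_rpow_le_of_growth {μ ω : Measure ℝ} {α : ℝ} {ν : Measure ℝ≥0} (hμ : IsClock μ)
    (hω : ω (Iic 0) = 0) (hα : 0 < α) {D : ℝ≥0∞}
    (hD : ∀ F : ℝ → ℝ≥0∞, Antitone F →
      (∀ r, 0 < r → (∫⁻ s in Iio r, F s ∂μ) ^ α ≤ fundamentalFunction (scale μ α) ν r) →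
      ∫⁻ s, F s ^ α ∂ω ≤ D)
    {c : ℝ≥0∞} (hc : c ≠ ∞) {F : ℝ → ℝ≥0∞} (hF : Antitone F)
    (h : ∀ r, 0 < r → (∫⁻ s in Iio r, F s ∂μ) ^ α ≤ c * fundamentalFunction (scale μ α) ν r) :
    ∫⁻ s, F s ^ α ∂ω ≤ c * D := by
  rcases eq_or_ne c 0 with rfl | hc0
  · have hzero : ∀ s, 0 < s → F s = 0 := fun s hs => by
      have h1 : (∫⁻ s in Iio s, F s ∂μ) ^ α = 0 := by simpa using h s hs
      have h2 : ∫⁻ s in Iio s, F s ∂μ = 0 := (ENNReal.rpow_eq_zero_iff_of_pos hα).1 h1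
      have h3 : F s * μ (Iio s) = 0 := by simpa [h2] using mul_measure_le_lintegral (μ := μ) hF s
      exact (mul_eq_zero.1 h3).resolve_right (hμ.pos s hs).ne'
    have : ∫⁻ s, F s ^ α ∂ω = 0 := by
      rw [← lintegral_zero (μ := ω)]
      refine lintegral_congr_ae ?_
      filter_upwards [ae_pos_of_null hω] with s hs
      rw [hzero s hs, ENNReal.zero_rpow_of_pos hα]
    rw [this]; exact zero_le
  have hpow : ∀ x : ℝ≥0∞, (c⁻¹ ^ (1 / α) * x) ^ α = c⁻¹ * x ^ α := fun x => by
    rw [ENNReal.mul_rpow_of_nonneg _ _ hα.le, one_div, ENNReal.rpow_inv_rpow hα.ne']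
  have key := hD (fun s => c⁻¹ ^ (1 / α) * F s) (fun s t hst => mul_le_mul_right (hF hst) _)
    fun r hr => by
      rw [lintegral_const_mul _ hF.measurable, hpow]
      calc c⁻¹ * (∫⁻ s in Iio r, F s ∂μ) ^ α
          ≤ c⁻¹ * (c * fundamentalFunction (scale μ α) ν r) := by gcongr; exact h r hr
        _ = _ := by rw [← mul_assoc, ENNReal.inv_mul_cancel hc0 hc, one_mul]
  simp_rw [hpow] at key
  rw [lintegral_const_mul _ (hF.measurable.pow_const _)] at key
  calc ∫⁻ s, F s ^ α ∂ω = c * (c⁻¹ * ∫⁻ s, F s ^ α ∂ω) := by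
        rw [← mul_assoc, ENNReal.mul_inv_cancel hc0 hc, one_mul]
    _ ≤ _ := by gcongr

/-- The embedding holds if and only if the gain is integrable with respect to the representation
measure. -/
theorem embeds_iff_lintegral_gain_lt_top {n : ℕ} (hn : 1 ≤ n) (hp : 0 < p) (hq : 0 < q)
    {φ : ℝ → ℝ≥0∞} (hψ : AEMeasurable ψ (volume.restrict (Ioi 0)))
    (hw : AEMeasurable w (volume.restrict (Ioi 0)))
    (hφ : ∀ r ∈ Ioi (0 : ℝ), 0 < φ r ∧ φ r < ∞) (hΨ : IsAdmissible (Psi p q ψ)) {ν : Measure ℝ≥0}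
    (hν : IsRepresentationMeasure (Psi p q ψ) (fun t => 1 / φ t ^ q) ν) :
    Embeds n p q ψ φ w ↔
      ∫⁻ s : ℝ≥0, gain (weighted p ψ) (weighted q w) (q / p) s ∂ν < ∞ := by
  have hμ := isClock_weighted hp hq hΨ
  have hω := weighted_Iic_zero q w
  set μ := weighted p ψ
  set ω := weighted q w
  have hα : 0 < q / p := by positivity
  obtain ⟨C₀, hC₀⟩ := hν
  simp only [Psi_eq hq] at hC₀
  set A := fundamentalFunction (scale μ (q / p)) ν with hA
  have hφ0 : ∀ t, 0 < t → φ t ^ q ≠ 0 := fun t ht =>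
    (ENNReal.rpow_pos (hφ t ht).1 (hφ t ht).2.ne).ne'
  have hφt : ∀ t, 0 < t → φ t ^ q ≠ ∞ := fun t ht =>
    ENNReal.rpow_ne_top_of_nonneg hq.le (hφ t ht).2.ne
  have hApos : ∀ t, 0 < t → 0 < A t ∧ A t < ∞ := fun t ht => by
    constructor
    · by_contra hcon
      have h1 := (hC₀ t ht).1
      rw [nonpos_iff_eq_zero.1 (not_lt.1 hcon), mul_zero, nonpos_iff_eq_zero, one_div,
        ENNReal.inv_eq_zero] at h1
      exact hφt t ht h1
    · refine (hC₀ t ht).2.trans_lt (ENNReal.mul_lt_top ENNReal.coe_lt_top ?_)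
      rw [one_div]
      exact ENNReal.inv_lt_top.2 (pos_iff_ne_zero.2 (hφ0 t ht))
  have hpq : ∀ x : ℝ≥0∞, (x ^ p) ^ (q / p) = x ^ q := fun x => by
    rw [← ENNReal.rpow_mul, mul_div_cancel₀ q hp.ne']
  constructor
  · rintro ⟨-, C', hC'⟩
    obtain ⟨C, hCt, hC⟩ := exists_lintegral_gain_le (ω := ω) hμ hα hApos
    refine (hC ((C' * (C₀ : ℝ≥0∞) ^ (1 / q)) ^ q) fun F hF hFr => ?_).trans_lt ?_
    · obtain ⟨f, hfm, hf⟩ := exists_rearrangement_ae_eq hn (g := fun s => F s ^ (1 / p))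
        fun s t hst => ENNReal.rpow_le_rpow (hF hst) (by positivity)
      have hfμ : ∀ᵐ s ∂μ, rearrangement f s ^ p = F s :=
        (withDensity_absolutelyContinuous _ _).ae_le (hf.mono fun s hs => by
          rw [hs, one_div, ENNReal.rpow_inv_rpow hp.ne'])
      have hfω : ∀ᵐ s ∂ω, rearrangement f s ^ q = F s ^ (q / p) :=
        (withDensity_absolutelyContinuous _ _).ae_le (hf.mono fun s hs => by
          rw [hs, ← ENNReal.rpow_mul, one_div_mul_eq_div])
      have hG : gLambdaNorm p ψ φ f ≤ (C₀ : ℝ≥0∞) ^ (1 / q) := by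
        refine iSup₂_le fun r (hr : 0 < r) => ?_
        rw [lpOn_mul_eq hp hψ (antitone_rearrangement f).measurable,
          lintegral_congr_ae (ae_restrict_of_ae hfμ)]
        have h1 : ((∫⁻ s in Iio r, F s ∂μ) ^ (1 / p)) ^ q ≤ C₀ * (1 / φ r ^ q) := by
          rw [← ENNReal.rpow_mul, one_div_mul_eq_div]
          exact (hFr r hr).trans (hC₀ r hr).2
        have h2 : (φ r * (∫⁻ s in Iio r, F s ∂μ) ^ (1 / p)) ^ q ≤ C₀ := by
          rw [ENNReal.mul_rpow_of_nonneg _ _ hq.le]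
          calc φ r ^ q * ((∫⁻ s in Iio r, F s ∂μ) ^ (1 / p)) ^ q
              ≤ φ r ^ q * (C₀ * (1 / φ r ^ q)) := by gcongr
            _ = (φ r ^ q * (φ r ^ q)⁻¹) * C₀ := by rw [one_div]; ring
            _ = C₀ := by rw [ENNReal.mul_inv_cancel (hφ0 r hr) (hφt r hr), one_mul]
        rw [one_div q]
        exact (ENNReal.le_rpow_inv_iff hq).2 h2
      have hfG : f ∈ GLambda n p ψ φ := ⟨hfm.aemeasurable, hG.trans_lt
        (ENNReal.rpow_lt_top_of_nonneg (by positivity) ENNReal.coe_ne_top)⟩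
      have h3 := hC' f hfG
      rw [lambdaNorm_eq hq hw, lintegral_congr_ae hfω] at h3
      calc ∫⁻ s, F s ^ (q / p) ∂ω = ((∫⁻ s, F s ^ (q / p) ∂ω) ^ (1 / q)) ^ q := by
            rw [one_div, ENNReal.rpow_inv_rpow hq.ne']
        _ ≤ _ := by
            gcongr
            exact h3.trans (by gcongr)
    · refine ENNReal.mul_lt_top hCt.lt_top (ENNReal.rpow_lt_top_of_nonneg hq.le ?_)
      exact ENNReal.mul_ne_top ENNReal.coe_ne_top
        (ENNReal.rpow_ne_top_of_nonneg (by positivity) ENNReal.coe_ne_top)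
  · intro hX
    obtain ⟨C, hCt, hC⟩ := exists_lintegral_rpow_le (ω := ω) hμ hω hα hApos
    set X := ∫⁻ s : ℝ≥0, gain μ ω (q / p) s ∂ν
    have hconst : ((C₀ : ℝ≥0∞) * (C * X)) ^ (1 / q) ≠ ∞ :=
      ENNReal.rpow_ne_top_of_nonneg (by positivity)
        (ENNReal.mul_ne_top ENNReal.coe_ne_top (ENNReal.mul_ne_top hCt hX.ne))
    have key : ∀ f ∈ GLambda n p ψ φ, lambdaNorm q w f
        ≤ ((C₀ : ℝ≥0∞) * (C * X)) ^ (1 / q) * gLambdaNorm p ψ φ f := by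
      intro f hf
      set M := gLambdaNorm p ψ φ f with hM
      have hMt : M ^ q * C₀ ≠ ∞ := ENNReal.mul_ne_top
        (ENNReal.rpow_ne_top_of_nonneg hq.le hf.2.ne) ENNReal.coe_ne_top
      have hanti : Antitone fun s => rearrangement f s ^ p := fun s t hst =>
        ENNReal.rpow_le_rpow (antitone_rearrangement f hst) hp.le
      have h1 := lintegral_rpow_le_of_growth hμ hω hα (fun F hF hFr => hC F hF hFr) hMt hanti
        fun r hr => by
          have h2 : φ r * (∫⁻ s in Iio r, rearrangement f s ^ p ∂μ) ^ (1 / p) ≤ M := by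
            rw [← lpOn_mul_eq hp hψ (antitone_rearrangement f).measurable]
            exact le_iSup₂_of_le (f := fun r (_ : r ∈ Ioi (0 : ℝ)) =>
              φ r * lpOn p (fun t => ψ t * rearrangement f t) (Ioo 0 r)) r hr le_rfl
          calc (∫⁻ s in Iio r, rearrangement f s ^ p ∂μ) ^ (q / p)
              = (φ r ^ q * (φ r ^ q)⁻¹) *
                  ((∫⁻ s in Iio r, rearrangement f s ^ p ∂μ) ^ (1 / p)) ^ q := by
                rw [ENNReal.mul_inv_cancel (hφ0 r hr) (hφt r hr), one_mul, ← ENNReal.rpow_mul,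
                  one_div_mul_eq_div]
            _ = (φ r * (∫⁻ s in Iio r, rearrangement f s ^ p ∂μ) ^ (1 / p)) ^ q
                  * (1 / φ r ^ q) := by
                rw [ENNReal.mul_rpow_of_nonneg _ _ hq.le, one_div (φ r ^ q)]; ring
            _ ≤ M ^ q * (C₀ * A r) := by
                gcongr
                exact (hC₀ r hr).1
            _ = _ := by ring
      simp_rw [hpq] at h1
      rw [lambdaNorm_eq hq hw]
      calc (∫⁻ s, rearrangement f s ^ q ∂ω) ^ (1 / q)
          ≤ (M ^ q * C₀ * (C * X)) ^ (1 / q) := by gcongr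
        _ = _ := by
            rw [mul_assoc, ENNReal.mul_rpow_of_nonneg _ _ (by positivity : 0 ≤ 1 / q), one_div,
              ENNReal.rpow_rpow_inv hq.ne', mul_comm]
    refine ⟨fun f hf => ⟨hf.1, (key f hf).trans_lt (ENNReal.mul_lt_top hconst.lt_top hf.2)⟩,
      (((C₀ : ℝ≥0∞) * (C * X)) ^ (1 / q)).toNNReal, fun f hf => ?_⟩
    rw [ENNReal.coe_toNNReal hconst]
    exact key f hf

/-! ### Explicit forms of the gain -/

lemma lintegral_lt_top_iff_of_equiv {X : Type*} [MeasurableSpace X] {ρ : Measure X}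
    {f g : X → ℝ≥0∞} {C D : ℝ≥0∞} (hC : C ≠ ∞) (hD : D ≠ ∞) (h1 : ∀ x, f x ≤ C * g x)
    (h2 : ∀ x, g x ≤ D * f x) : ∫⁻ x, f x ∂ρ < ∞ ↔ ∫⁻ x, g x ∂ρ < ∞ := by
  constructor <;> intro h
  · refine (lintegral_mono h2).trans_lt ?_
    rw [lintegral_const_mul' _ _ hD]
    exact ENNReal.mul_lt_top hD.lt_top h
  · refine (lintegral_mono h1).trans_lt ?_
    rw [lintegral_const_mul' _ _ hC]
    exact ENNReal.mul_lt_top hC.lt_top h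

theorem lintegral_gain_lt_top_iff_supIntegral (hp : 0 < p) (hq : 0 < q) (hpq : p ≤ q)
    (hΨ : IsAdmissible (Psi p q ψ)) {ν : Measure ℝ≥0} :
    ∫⁻ s : ℝ≥0, gain (weighted p ψ) (weighted q w) (q / p) s ∂ν < ∞ ↔
      supIntegral p q ψ w ν < ∞ := by
  have hμ := isClock_weighted hp hq hΨ
  have hα : 1 ≤ q / p := (one_le_div hp).2 hpq
  unfold supIntegral
  simp_rw [primitivePow_eq, Psi_eq hq]
  refine lintegral_lt_top_iff_of_equiv (C := ENNReal.ofReal (q / p)) (D := 1) (by simp) (by simp)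
    (fun t => gain_le_mul_iSup_div hμ (weighted_Iic_zero q w) hα t.2) fun t => ?_
  rw [one_mul]
  exact iSup_div_le_gain hμ (zero_lt_one.trans_le hα) t.2

theorem lintegral_gain_lt_top_iff_conjIntegral (hp : 0 < p) (hq : 0 < q) (hqp : q < p)
    (hψ : AEMeasurable ψ (volume.restrict (Ioi 0))) (hΨ : IsAdmissible (Psi p q ψ))
    {ν : Measure ℝ≥0} :
    ∫⁻ s : ℝ≥0, gain (weighted p ψ) (weighted q w) (q / p) s ∂ν < ∞ ↔
      conjIntegral p q ψ w ν < ∞ := by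
  have hμ := isClock_weighted hp hq hΨ
  have hα : 0 < q / p := by positivity
  have hα1 : q / p < 1 := (div_lt_one hp).2 hqp
  have hconj : (p / q).conjExponent = (1 - q / p)⁻¹ := by
    have h1 : p - q ≠ 0 := by linarith
    rw [Real.conjExponent]
    field_simp
  have hpow : ∀ s, Psi p q ψ s ^ (p / q) = weighted p ψ (Iio s) := fun s => by
    rw [Psi_eq hq, scale, ← ENNReal.rpow_mul, div_mul_div_cancel₀ hp.ne', div_self hq.ne',
      ENNReal.rpow_one]
  have heq : conjIntegral p q ψ w ν = ∫⁻ t : ℝ≥0, (∫⁻ y in Ioi (t : ℝ),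
      (weighted q w (Iio y) / weighted p ψ (Iio y)) ^ (1 - q / p)⁻¹ ∂(weighted p ψ))
        ^ (1 - q / p) ∂ν := by
    refine lintegral_congr fun t => ?_
    have hm : Measurable fun y =>
        (weighted q w (Iio y) / weighted p ψ (Iio y)) ^ (1 - q / p)⁻¹ :=
      ((measurable_measure_Iio _).div (measurable_measure_Iio _)).pow_const _
    rw [hconj, one_div, inv_inv, setLIntegral_weighted hψ measurableSet_Ioi hm,
      Ioi_inter_Ioi, max_eq_left t.coe_nonneg]
    simp_rw [hpow, primitivePow_eq, mul_comm]
  obtain ⟨C, hC, h1⟩ := exists_gain_le_mul_lintegral hμ (weighted_Iic_zero q w) hα hα1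
  obtain ⟨D, hD, h2⟩ := exists_lintegral_le_mul_gain hμ (weighted_Iic_zero q w) hα hα1
  rw [heq]
  exact lintegral_lt_top_iff_of_equiv hC hD (fun t => h1 t t.2) fun t => h2 t t.2

end

end LorentzEmb

theorem mainTheorem2 (n : ℕ) (hn : 1 ≤ n) (p q : ℝ) (hp : 0 < p) (hq : 0 < q)
    (ψ w φ : ℝ → ℝ≥0∞)
    (hψ : AEMeasurable ψ (volume.restrict (Ioi 0)))
    (hw : AEMeasurable w (volume.restrict (Ioi 0)))
    (hφpos : ∀ r ∈ Ioi (0 : ℝ), 0 < φ r ∧ φ r < ∞)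
    (hφanti : AntitoneOn φ (Ioi 0))
    (hφmono : MonotoneOn (fun r => φ r * ENNReal.ofReal r ^ (1 / p)) (Ioi 0))
    (hΨ : LorentzEmb.IsAdmissible (LorentzEmb.Psi p q ψ))
    (ν : Measure ℝ≥0)
    (hν : LorentzEmb.IsRepresentationMeasure (LorentzEmb.Psi p q ψ) (fun t => 1 / φ t ^ q) ν) :
    (p ≤ q → (LorentzEmb.Embeds n p q ψ φ w ↔ LorentzEmb.supIntegral p q ψ w ν < ∞)) ∧
    (q < p → (LorentzEmb.Embeds n p q ψ φ w ↔ LorentzEmb.conjIntegral p q ψ w ν < ∞)) := by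
  have main := LorentzEmb.embeds_iff_lintegral_gain_lt_top hn hp hq hψ hw hφpos hΨ hν
  exact ⟨fun h => main.trans (LorentzEmb.lintegral_gain_lt_top_iff_supIntegral hp hq h hΨ),
    fun h => main.trans (LorentzEmb.lintegral_gain_lt_top_iff_conjIntegral hp hq h hψ hΨ)⟩
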